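/- Fix an integer $c \ge 2$. The problem $\mathrm{succETR}^{1/8}_{[-1/8,1/8]}$: an instance consists of seven Boolean circuits $C_0,\dots,C_6:\{0,1\}^M\to\{0,1\}^N$ over the basis $\{\neg,\wedge,\vee\}$ (input nodes are counted in the size). It is a yes-instance if there are real numbers $x_e\in[-\tfrac18,\tfrac18]$, $e\in\{0,1\}^N$, such that for every $j\in\{0,1\}^M$ $$x_{C_0(j)}=\tfrac18,\qquad x_{C_1(j)}+x_{C_2(j)}=x_{C_3(j)},\qquad x_{C_4(j)}\cdot x_{C_5(j)}=x_{C_6(j)}.$$ The problem $\mathrm{Sat}_{prob}$: events are given by the grammar $\delta ::= X=x \mid \neg\delta\mid\delta\wedge\delta$, where $X$ is one of the random variables $X_0,X_1,\dots$ with values in $\{0,\dots,c-1\}$ and $x$ is either such a value or a summation variable; terms by $\mathbf e::=\mathbb P(\delta)\mid\mathbb P(\delta\mid\delta')\mid\mathbf e+\mathbf e\mid\mathbf e\cdot\mathbf e\mid\sum_x\mathbf e$, where the summation variable $x$ ranges over $0,\dots,c-1$; formulas by $\varphi::=\mathbf e\le\mathbf e\mid\neg\varphi\mid\varphi\wedge\varphi$,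 where every summation variable has to be bound by a sum. Terms and formulas are interpreted in recursive structural causal models (finitely many endogenous variables $X_0,\dots,X_{n-1}$ that include those of the formula, each computed by a measurable function from its predecessors and from exogenous variables with an arbitrary joint probability distribution), with $\mathbb P(\delta\mid\delta')=\mathbb P(\delta\wedge\delta')/\mathbb P(\delta')$, read as $0$ if $\mathbb P(\delta')=0$. A formula $\varphi$ is a yes-instance if some such model satisfies it. Then $\mathrm{succETR}^{1/8}_{[-1/8,1/8]}\le_p \mathrm{Sat}_{prob}$, that is, there is a polynomial-time many-one reduction from the first problem to the second. -/

import Mathlib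

/-! ## Polynomial-time many-one reductions -/

/-- `A ≤ₚ B` for decision problems `A` and `B` whose instances are written as strings over finite
alphabets: some `f`, computed by a Turing machine in time polynomial in the length of the encoded
instance, maps yes-instances to yes-instances and no-instances to no-instances. -/
def PolyTimeReducible {α β Γ Δ : Type} [Fintype Γ] [Fintype Δ]
    (ea : Computability.Encoding α Γ) (eb : Computability.Encoding β Δ)
    (A : Set α) (B : Set β) : Prop :=
  ∃ f : α → β, Nonempty (Turing.TM2ComputableInPolyTime ea.encode eb.encode f) ∧
    ∀ a, a ∈ A ↔ f a ∈ B

open Classical in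
/-- An injective map into strings is an encoding in Mathlib's sense. -/
noncomputable def encodingOfInjective {α Γ : Type} (enc : α → List Γ)
    (h : Function.Injective enc) : Computability.Encoding α Γ where
  encode := enc
  decode s := if hs : ∃ a, enc a = s then some hs.choose else none
  decode_encode a := by
    have hs : ∃ a', enc a' = enc a := ⟨a, rfl⟩
    rw [dif_pos hs]
    exact congrArg some (h hs.choose_spec)

/-- A number, written as `n` strokes followed by a separator. -/
def strokes {Γ : Type} (one sep : Γ) (n : ℕ) : List Γ :=
  List.replicate n one ++ [sep]

theorem strokes_append_inj {Γ : Type} {one sep : Γ} (hne : one ≠ sep) :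
    ∀ {m n : ℕ} {s t : List Γ},
      strokes one sep m ++ s = strokes one sep n ++ t → m = n ∧ s = t
  | 0, 0, s, t, h => by simpa [strokes] using h
  | 0, n + 1, s, t, h => by
      simp [strokes, List.replicate_succ] at h
      exact absurd h.1.symm hne
  | m + 1, 0, s, t, h => by
      simp [strokes, List.replicate_succ] at h
      exact absurd h.1 hne
  | m + 1, n + 1, s, t, h => by
      have h' : strokes one sep m ++ s = strokes one sep n ++ t := by
        simpa [strokes, List.replicate_succ] using h
      obtain ⟨h1, h2⟩ := strokes_append_inj hne h'
      exact ⟨by rw [h1], h2⟩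

/-! ## Boolean circuits -/

/-- An inner node of a circuit, with its children among the first `n` nodes. -/
inductive Gate (n : ℕ) : Type
  | neg (u : Fin n)
  | conj (u w : Fin n)
  | disj (u w : Fin n)

/-- The inner nodes of a circuit in topological order: `GateList n m` extends `n` given nodes to
`m` nodes, every gate reading only nodes that precede it. Fan-out is unbounded. -/
inductive GateList : ℕ → ℕ → Type
  | nil (n : ℕ) : GateList n n
  | cons {n m : ℕ} (g : Gate n) (rest : GateList (n + 1) m) : GateList n m

/-- A Boolean circuit with `M` input nodes (the nodes `0, …, M - 1`) and `N` output nodes. -/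
structure Circuit (M N : ℕ) : Type where
  nodes : ℕ
  gates : GateList M nodes
  out : Fin N → Fin nodes

def Gate.eval {n : ℕ} (v : Fin n → Bool) : Gate n → Bool
  | .neg u => !(v u)
  | .conj u w => v u && v w
  | .disj u w => v u || v w

/-- The values of all nodes, from the values of the first `n`. -/
def GateList.eval : {n m : ℕ} → GateList n m → (Fin n → Bool) → (Fin m → Bool)
  | _, _, .nil _, v => v
  | _, _, .cons g rest, v => rest.eval (Fin.snoc (α := fun _ => Bool) v (g.eval v))

/-- The function `{0,1}^M → {0,1}^N` that the circuit computes. -/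
def Circuit.eval {M N : ℕ} (C : Circuit M N) (j : Fin M → Bool) : Fin N → Bool :=
  fun k => C.gates.eval j (C.out k)

/-! ## The succinct problem `ETR^c_[a,b]` -/

/-- An instance: seven circuits `C₀, …, C₆ : {0,1}^M → {0,1}^N`. -/
structure SuccInstance : Type where
  M : ℕ
  N : ℕ
  C : Fin 7 → Circuit M N

/-- The yes-instances. The real variables are `x_e` with `e ∈ {0,1}^N`, and each `j ∈ {0,1}^M`
gives one equation of each of the three types. -/
def SuccETR (c a b : ℝ) : Set SuccInstance :=
  {I | ∃ x : (Fin I.N → Bool) → ℝ, (∀ e, x e ∈ Set.Icc a b) ∧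
    ∀ j : Fin I.M → Bool,
      x ((I.C 0).eval j) = c ∧
      x ((I.C 1).eval j) + x ((I.C 2).eval j) = x ((I.C 3).eval j) ∧
      x ((I.C 4).eval j) * x ((I.C 5).eval j) = x ((I.C 6).eval j)}

/-- The alphabet in which instances are written. -/
inductive CSym : Type
  | one | sep | neg | conj | disj | out | done
  deriving DecidableEq

instance : Fintype CSym where
  elems := {.one, .sep, .neg, .conj, .disj, .out, .done}
  complete s := by cases s <;> simp

/-- Node numbers are written in unary. They are smaller than the number of nodes, so that the
length of the string is polynomially related to the number of nodes. -/
def CSym.num (n : ℕ) : List CSym := strokes CSym.one CSym.sep n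

def Gate.encode {n : ℕ} : Gate n → List CSym
  | .neg u => CSym.neg :: CSym.num u
  | .conj u w => CSym.conj :: (CSym.num u ++ CSym.num w)
  | .disj u w => CSym.disj :: (CSym.num u ++ CSym.num w)

def GateList.encode : {n m : ℕ} → GateList n m → List CSym
  | _, _, .nil _ => [CSym.out]
  | _, _, .cons g rest => g.encode ++ rest.encode

/-- All gates in order, then the numbers of the output nodes. -/
def Circuit.encode {M N : ℕ} (C : Circuit M N) : List CSym :=
  C.gates.encode ++
    ((List.ofFn fun k => CSym.num (C.out k)).flatten ++ [CSym.done])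

/-- `M` and `N` in unary, then the seven circuits. -/
def SuccInstance.encode (I : SuccInstance) : List CSym :=
  CSym.num I.M ++ (CSym.num I.N ++ (List.ofFn fun i => (I.C i).encode).flatten)

theorem CSym.num_append_inj {m n : ℕ} {s t : List CSym}
    (h : CSym.num m ++ s = CSym.num n ++ t) : m = n ∧ s = t :=
  strokes_append_inj (by decide) h

theorem Gate.encode_append_inj {n : ℕ} {g g' : Gate n} {s t : List CSym}
    (h : g.encode ++ s = g'.encode ++ t) : g = g' ∧ s = t := by
  cases g <;> cases g' <;>
    simp only [Gate.encode, List.cons_append, List.append_assoc, List.cons.injEq, reduceCtorEq,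
      true_and, false_and] at h
  · obtain ⟨h1, h2⟩ := CSym.num_append_inj h
    exact ⟨by rw [Fin.ext h1], h2⟩
  · obtain ⟨h1, h2⟩ := CSym.num_append_inj h
    obtain ⟨h3, h4⟩ := CSym.num_append_inj h2
    exact ⟨by rw [Fin.ext h1, Fin.ext h3], h4⟩
  · obtain ⟨h1, h2⟩ := CSym.num_append_inj h
    obtain ⟨h3, h4⟩ := CSym.num_append_inj h2
    exact ⟨by rw [Fin.ext h1, Fin.ext h3], h4⟩

theorem GateList.encode_append_inj {n m : ℕ} (G : GateList n m) :
    ∀ {m' : ℕ} (G' : GateList n m') {s t : List CSym},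
      G.encode ++ s = G'.encode ++ t → m = m' ∧ HEq G G' ∧ s = t := by
  induction G with
  | nil n =>
    intro m' G' s t h
    cases G' with
    | nil => simpa [GateList.encode] using h
    | cons g rest => cases g <;> simp [GateList.encode, Gate.encode] at h
  | cons g rest ih =>
    intro m' G' s t h
    cases G' with
    | nil => cases g <;> simp [GateList.encode, Gate.encode] at h
    | cons g' rest' =>
      simp only [GateList.encode, List.append_assoc] at h
      obtain ⟨rfl, h1⟩ := Gate.encode_append_inj h
      obtain ⟨rfl, h2, h3⟩ := ih rest' h1
      obtain rfl := eq_of_heq h2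
      exact ⟨rfl, HEq.rfl, h3⟩

theorem flatten_ofFn_append_inj {α Γ : Type} (enc : α → List Γ)
    (henc : ∀ {x y : α} {s t : List Γ}, enc x ++ s = enc y ++ t → x = y ∧ s = t) :
    ∀ {k : ℕ} {f g : Fin k → α} {s t : List Γ},
      (List.ofFn fun i => enc (f i)).flatten ++ s =
        (List.ofFn fun i => enc (g i)).flatten ++ t → f = g ∧ s = t := by
  intro k
  induction k with
  | zero =>
    intro f g s t h
    exact ⟨Subsingleton.elim _ _, by simpa using h⟩
  | succ k ih =>
    intro f g s t h
    simp only [List.ofFn_succ, List.flatten_cons, List.append_assoc] at h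
    obtain ⟨h0, h1⟩ := henc h
    obtain ⟨h2, h3⟩ := ih (f := fun i => f i.succ) (g := fun i => g i.succ) h1
    refine ⟨funext fun i => ?_, h3⟩
    refine Fin.cases h0 (fun i => ?_) i
    exact congrFun h2 i

theorem Circuit.encode_append_inj {M N : ℕ} {C C' : Circuit M N} {s t : List CSym}
    (h : C.encode ++ s = C'.encode ++ t) : C = C' ∧ s = t := by
  obtain ⟨m, G, o⟩ := C
  obtain ⟨m', G', o'⟩ := C'
  simp only [Circuit.encode, List.append_assoc] at h
  obtain ⟨rfl, h1, h2⟩ := GateList.encode_append_inj G G' h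
  obtain rfl := eq_of_heq h1
  obtain ⟨h3, h4⟩ := flatten_ofFn_append_inj (fun u : Fin m => CSym.num u)
    (fun h => ⟨Fin.ext (CSym.num_append_inj h).1, (CSym.num_append_inj h).2⟩) h2
  subst h3
  exact ⟨rfl, by simpa using h4⟩

theorem SuccInstance.encode_injective : Function.Injective SuccInstance.encode := by
  rintro ⟨M, N, C⟩ ⟨M', N', C'⟩ h
  simp only [SuccInstance.encode] at h
  obtain ⟨rfl, h1⟩ := CSym.num_append_inj h
  obtain ⟨rfl, h2⟩ := CSym.num_append_inj h1
  obtain ⟨rfl, -⟩ := flatten_ofFn_append_inj (fun D : Circuit M N => D.encode)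
    Circuit.encode_append_inj (congrArg (· ++ []) h2)
  rfl

noncomputable def SuccInstance.encoding : Computability.Encoding SuccInstance CSym :=
  encodingOfInjective SuccInstance.encode SuccInstance.encode_injective

/-! ## The probabilistic language over the values `0, …, c - 1` -/

/-- The right-hand side of `X = x`: a value, or a summation variable (named by a number). -/
inductive ValTerm (c : ℕ) : Type
  | const (v : Fin c)
  | dummy (y : ℕ)

/-- Events: Boolean conditions on the values of the random variables `X₀, X₁, …`. -/
inductive PropFormula (c : ℕ) : Type
  | eq (X : ℕ) (x : ValTerm c)
  | neg (δ : PropFormula c)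
  | conj (δ δ' : PropFormula c)

/-- Arithmetic terms: `P(δ)`, `P(δ | δ')`, sums, products and `∑_y e`. -/
inductive ProbTerm (c : ℕ) : Type
  | prob (δ : PropFormula c)
  | cond (δ δ' : PropFormula c)
  | add (e e' : ProbTerm c)
  | mul (e e' : ProbTerm c)
  | sum (y : ℕ) (e : ProbTerm c)

/-- Boolean combinations of inequalities between terms. -/
inductive ProbFormula (c : ℕ) : Type
  | le (e e' : ProbTerm c)
  | neg (φ : ProbFormula c)
  | conj (φ φ' : ProbFormula c)

/-! ### Summation variables are bound, random variables belong to the model -/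

def ValTerm.BoundIn {c : ℕ} (B : Set ℕ) : ValTerm c → Prop
  | .const _ => True
  | .dummy y => y ∈ B

/-- All summation variables of `δ` lie in `B`. -/
def PropFormula.BoundIn {c : ℕ} (B : Set ℕ) : PropFormula c → Prop
  | .eq _ x => x.BoundIn B
  | .neg δ => δ.BoundIn B
  | .conj δ δ' => δ.BoundIn B ∧ δ'.BoundIn B

/-- All free summation variables of `e` lie in `B`. -/
def ProbTerm.BoundIn {c : ℕ} : Set ℕ → ProbTerm c → Prop
  | B, .prob δ => δ.BoundIn B
  | B, .cond δ δ' => δ.BoundIn B ∧ δ'.BoundIn B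
  | B, .add e e' => e.BoundIn B ∧ e'.BoundIn B
  | B, .mul e e' => e.BoundIn B ∧ e'.BoundIn B
  | B, .sum y e => e.BoundIn (insert y B)

/-- Every summation variable occurs in the scope of a summation over it. -/
def ProbFormula.Closed {c : ℕ} : ProbFormula c → Prop
  | .le e e' => e.BoundIn ∅ ∧ e'.BoundIn ∅
  | .neg φ => φ.Closed
  | .conj φ φ' => φ.Closed ∧ φ'.Closed

/-- All random variables of `δ` are among `X₀, …, X_{n-1}`. -/
def PropFormula.VarsBelow {c : ℕ} (n : ℕ) : PropFormula c → Prop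
  | .eq X _ => X < n
  | .neg δ => δ.VarsBelow n
  | .conj δ δ' => δ.VarsBelow n ∧ δ'.VarsBelow n

def ProbTerm.VarsBelow {c : ℕ} (n : ℕ) : ProbTerm c → Prop
  | .prob δ => δ.VarsBelow n
  | .cond δ δ' => δ.VarsBelow n ∧ δ'.VarsBelow n
  | .add e e' => e.VarsBelow n ∧ e'.VarsBelow n
  | .mul e e' => e.VarsBelow n ∧ e'.VarsBelow n
  | .sum _ e => e.VarsBelow n

def ProbFormula.VarsBelow {c : ℕ} (n : ℕ) : ProbFormula c → Prop
  | .le e e' => e.VarsBelow n ∧ e'.VarsBelow n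
  | .neg φ => φ.VarsBelow n
  | .conj φ φ' => φ.VarsBelow n ∧ φ'.VarsBelow n

/-! ## Structural causal models -/

/-- A recursive structural causal model with endogenous variables `X₀, …, X_{n-1}` that take
values in `{0, …, c - 1}`. The exogenous variables are indexed by `Exo` and have the joint
distribution `P`; the function `F i` computes `X_i` from the preceding endogenous variables and
the exogenous ones. -/
structure SCM (n c : ℕ) : Type 1 where
  Exo : Type
  Dom : Exo → Type
  measurableSpace : ∀ k, MeasurableSpace (Dom k)
  P : MeasureTheory.Measure (∀ k, Dom k)
  isProbabilityMeasure : MeasureTheory.IsProbabilityMeasure P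
  F : (i : Fin n) → (Fin i → Fin c) → (∀ k, Dom k) → Fin c
  measurable_F : ∀ i x, Measurable (F i x)

/-- The values of the endogenous variables, calculated from the values `u` of the exogenous
ones. -/
def SCM.value {n c : ℕ} (𝔐 : SCM n c) (u : ∀ k, 𝔐.Dom k) (i : Fin n) : Fin c :=
  𝔐.F i (fun j => 𝔐.value u ⟨j, j.isLt.trans i.isLt⟩) u
termination_by i.val
decreasing_by exact j.isLt

/-! ### Semantics -/

def ValTerm.eval {c : ℕ} (ρ : ℕ → Fin c) : ValTerm c → Fin c
  | .const v => v
  | .dummy y => ρ y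

/-- Truth of `δ` when the random variables have the values `x` and the summation variables have
been replaced with the values `ρ`. -/
def PropFormula.Holds {n c : ℕ} (x : Fin n → Fin c) (ρ : ℕ → Fin c) : PropFormula c → Prop
  | .eq X v => ∃ h : X < n, x ⟨X, h⟩ = v.eval ρ
  | .neg δ => ¬ δ.Holds x ρ
  | .conj δ δ' => δ.Holds x ρ ∧ δ'.Holds x ρ

/-- The probability of the event `δ` in the model. -/
noncomputable def SCM.probability {n c : ℕ} (𝔐 : SCM n c) (ρ : ℕ → Fin c)
    (δ : PropFormula c) : ℝ :=
  (𝔐.P {u | δ.Holds (𝔐.value u) ρ}).toReal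

/-- The value of a term. A conditional probability whose condition has probability zero is
given the value `0`. -/
noncomputable def ProbTerm.eval {n c : ℕ} (𝔐 : SCM n c) : (ℕ → Fin c) → ProbTerm c → ℝ
  | ρ, .prob δ => 𝔐.probability ρ δ
  | ρ, .cond δ δ' => 𝔐.probability ρ (.conj δ δ') / 𝔐.probability ρ δ'
  | ρ, .add e e' => e.eval 𝔐 ρ + e'.eval 𝔐 ρ
  | ρ, .mul e e' => e.eval 𝔐 ρ * e'.eval 𝔐 ρ
  | ρ, .sum y e => ∑ v : Fin c, e.eval 𝔐 (Function.update ρ y v)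

def ProbFormula.Holds {n c : ℕ} (𝔐 : SCM n c) (ρ : ℕ → Fin c) : ProbFormula c → Prop
  | .le e e' => e.eval 𝔐 ρ ≤ e'.eval 𝔐 ρ
  | .neg φ => ¬ φ.Holds 𝔐 ρ
  | .conj φ φ' => φ.Holds 𝔐 ρ ∧ φ'.Holds 𝔐 ρ

/-- `𝔐 ⊨ φ`. If `φ` is closed, its truth does not depend on `ρ`. -/
def SCM.Models {n c : ℕ} (𝔐 : SCM n c) (φ : ProbFormula c) : Prop :=
  ∀ ρ : ℕ → Fin c, φ.Holds 𝔐 ρ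

/-- The satisfiable formulas of the probabilistic language. -/
def SatProb (c : ℕ) : Set (ProbFormula c) :=
  {φ | φ.Closed ∧ ∃ n : ℕ, φ.VarsBelow n ∧ ∃ 𝔐 : SCM n c, 𝔐.Models φ}

/-! ### Formulas as strings -/

/-- The alphabet in which formulas are written. -/
inductive FSym : Type
  | one | sep | const | dummy | eq | neg | conj | prob | cond | add | mul | sum | le
  deriving DecidableEq

instance : Fintype FSym where
  elems := {.one, .sep, .const, .dummy, .eq, .neg, .conj, .prob, .cond, .add, .mul, .sum, .le}
  complete s := by cases s <;> simp

/-- The names of variables and the values are written in unary. After a renaming of the variables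
to an initial segment of the numbers, this is polynomially related to writing them in binary. -/
def FSym.num (n : ℕ) : List FSym := strokes FSym.one FSym.sep n

def ValTerm.encode {c : ℕ} : ValTerm c → List FSym
  | .const v => FSym.const :: FSym.num v
  | .dummy y => FSym.dummy :: FSym.num y

/-- Formulas are written in Polish notation. -/
def PropFormula.encode {c : ℕ} : PropFormula c → List FSym
  | .eq X x => FSym.eq :: (FSym.num X ++ x.encode)
  | .neg δ => FSym.neg :: δ.encode
  | .conj δ δ' => FSym.conj :: (δ.encode ++ δ'.encode)

def ProbTerm.encode {c : ℕ} : ProbTerm c → List FSym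
  | .prob δ => FSym.prob :: δ.encode
  | .cond δ δ' => FSym.cond :: (δ.encode ++ δ'.encode)
  | .add e e' => FSym.add :: (e.encode ++ e'.encode)
  | .mul e e' => FSym.mul :: (e.encode ++ e'.encode)
  | .sum y e => FSym.sum :: (FSym.num y ++ e.encode)

def ProbFormula.encode {c : ℕ} : ProbFormula c → List FSym
  | .le e e' => FSym.le :: (e.encode ++ e'.encode)
  | .neg φ => FSym.neg :: φ.encode
  | .conj φ φ' => FSym.conj :: (φ.encode ++ φ'.encode)

theorem FSym.num_append_inj {m n : ℕ} {s t : List FSym}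
    (h : FSym.num m ++ s = FSym.num n ++ t) : m = n ∧ s = t :=
  strokes_append_inj (by decide) h

theorem ValTerm.encode_append_inj {c : ℕ} {x x' : ValTerm c} {s t : List FSym}
    (h : x.encode ++ s = x'.encode ++ t) : x = x' ∧ s = t := by
  cases x <;> cases x' <;>
    simp only [ValTerm.encode, List.cons_append, List.cons.injEq, reduceCtorEq,
      true_and, false_and] at h
  · obtain ⟨h1, h2⟩ := FSym.num_append_inj h
    exact ⟨by rw [Fin.ext h1], h2⟩
  · obtain ⟨h1, h2⟩ := FSym.num_append_inj h
    exact ⟨by rw [h1], h2⟩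

theorem PropFormula.encode_append_inj {c : ℕ} (δ : PropFormula c) :
    ∀ {δ' : PropFormula c} {s t : List FSym},
      δ.encode ++ s = δ'.encode ++ t → δ = δ' ∧ s = t := by
  induction δ with
  | eq X x =>
    intro δ' s t h
    cases δ' <;>
      simp only [PropFormula.encode, List.cons_append, List.append_assoc, List.cons.injEq,
        reduceCtorEq, true_and, false_and] at h
    obtain ⟨rfl, h2⟩ := FSym.num_append_inj h
    obtain ⟨rfl, h3⟩ := ValTerm.encode_append_inj h2
    exact ⟨rfl, h3⟩
  | neg δ ih =>
    intro δ' s t h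
    cases δ' <;>
      simp only [PropFormula.encode, List.cons_append, List.append_assoc, List.cons.injEq,
        reduceCtorEq, true_and, false_and] at h
    obtain ⟨rfl, h3⟩ := ih h
    exact ⟨rfl, h3⟩
  | conj δ₁ δ₂ ih₁ ih₂ =>
    intro δ' s t h
    cases δ' <;>
      simp only [PropFormula.encode, List.cons_append, List.append_assoc, List.cons.injEq,
        reduceCtorEq, true_and, false_and] at h
    obtain ⟨rfl, h2⟩ := ih₁ h
    obtain ⟨rfl, h3⟩ := ih₂ h2
    exact ⟨rfl, h3⟩

theorem ProbTerm.encode_append_inj {c : ℕ} (e : ProbTerm c) :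
    ∀ {e' : ProbTerm c} {s t : List FSym},
      e.encode ++ s = e'.encode ++ t → e = e' ∧ s = t := by
  induction e with
  | prob δ =>
    intro e' s t h
    cases e' <;>
      simp only [ProbTerm.encode, List.cons_append, List.append_assoc, List.cons.injEq,
        reduceCtorEq, true_and, false_and] at h
    obtain ⟨rfl, h3⟩ := δ.encode_append_inj h
    exact ⟨rfl, h3⟩
  | cond δ₁ δ₂ =>
    intro e' s t h
    cases e' <;>
      simp only [ProbTerm.encode, List.cons_append, List.append_assoc, List.cons.injEq,
        reduceCtorEq, true_and, false_and] at h
    obtain ⟨rfl, h2⟩ := δ₁.encode_append_inj h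
    obtain ⟨rfl, h3⟩ := δ₂.encode_append_inj h2
    exact ⟨rfl, h3⟩
  | add e₁ e₂ ih₁ ih₂ =>
    intro e' s t h
    cases e' <;>
      simp only [ProbTerm.encode, List.cons_append, List.append_assoc, List.cons.injEq,
        reduceCtorEq, true_and, false_and] at h
    obtain ⟨rfl, h2⟩ := ih₁ h
    obtain ⟨rfl, h3⟩ := ih₂ h2
    exact ⟨rfl, h3⟩
  | mul e₁ e₂ ih₁ ih₂ =>
    intro e' s t h
    cases e' <;>
      simp only [ProbTerm.encode, List.cons_append, List.append_assoc, List.cons.injEq,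
        reduceCtorEq, true_and, false_and] at h
    obtain ⟨rfl, h2⟩ := ih₁ h
    obtain ⟨rfl, h3⟩ := ih₂ h2
    exact ⟨rfl, h3⟩
  | sum y e ih =>
    intro e' s t h
    cases e' <;>
      simp only [ProbTerm.encode, List.cons_append, List.append_assoc, List.cons.injEq,
        reduceCtorEq, true_and, false_and] at h
    obtain ⟨rfl, h2⟩ := FSym.num_append_inj h
    obtain ⟨rfl, h3⟩ := ih h2
    exact ⟨rfl, h3⟩

theorem ProbFormula.encode_append_inj {c : ℕ} (φ : ProbFormula c) :
    ∀ {φ' : ProbFormula c} {s t : List FSym},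
      φ.encode ++ s = φ'.encode ++ t → φ = φ' ∧ s = t := by
  induction φ with
  | le e₁ e₂ =>
    intro φ' s t h
    cases φ' <;>
      simp only [ProbFormula.encode, List.cons_append, List.append_assoc, List.cons.injEq,
        reduceCtorEq, true_and, false_and] at h
    obtain ⟨rfl, h2⟩ := e₁.encode_append_inj h
    obtain ⟨rfl, h3⟩ := e₂.encode_append_inj h2
    exact ⟨rfl, h3⟩
  | neg φ ih =>
    intro φ' s t h
    cases φ' <;>
      simp only [ProbFormula.encode, List.cons_append, List.append_assoc, List.cons.injEq,
        reduceCtorEq, true_and, false_and] at h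
    obtain ⟨rfl, h3⟩ := ih h
    exact ⟨rfl, h3⟩
  | conj φ₁ φ₂ ih₁ ih₂ =>
    intro φ' s t h
    cases φ' <;>
      simp only [ProbFormula.encode, List.cons_append, List.append_assoc, List.cons.injEq,
        reduceCtorEq, true_and, false_and] at h
    obtain ⟨rfl, h2⟩ := ih₁ h
    obtain ⟨rfl, h3⟩ := ih₂ h2
    exact ⟨rfl, h3⟩

theorem ProbFormula.encode_injective {c : ℕ} :
    Function.Injective (ProbFormula.encode (c := c)) := by
  intro φ φ' h
  exact (φ.encode_append_inj (congrArg (· ++ []) h)).1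

noncomputable def ProbFormula.encoding (c : ℕ) : Computability.Encoding (ProbFormula c) FSym :=
  encodingOfInjective ProbFormula.encode ProbFormula.encode_injective

/-!
The reduction asks for a model in which `q e = 4 * x e + 1/2 ∈ [0, 1]` is the conditional
probability that a variable `X₅` vanishes when the variables `E₀, …, E_{N-1}` spell out `e`. A
product of probabilities is required to be positive, which forces `X₀, …, X₄` to range over all rows
of the truth tables of `¬`, `∧` and `∨`. In a nested sum `∑ P(δ₁) * ∑ P(δ₂) * ⋯` over the values of
the nodes of the circuits, a weight `P(δ)` on `X₀, …, X₄` is then positive exactly if the gate is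
evaluated correctly, so that precisely the evaluations of the circuits contribute. The equations for
one input `j` hold iff a sum of squares and of `1 - q (C₀ j)` vanishes. This quantity is never
negative, so a single inequality between two such nested sums expresses the equations for all `j`
at once.
-/

/-! ## Nested weighted sums -/

theorem PropFormula.holds_conj {n c : ℕ} {x : Fin n → Fin c} {ρ : ℕ → Fin c}
    {δ δ' : PropFormula c} : (δ.conj δ').Holds x ρ ↔ δ.Holds x ρ ∧ δ'.Holds x ρ :=
  Iff.rfl

/-- A layer `∑_y P(δ) * ⋯` of a nested weighted sum: the summation variable `y` and the event `δ`
whose probability is the weight. -/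
structure SumLayer (c : ℕ) : Type where
  var : ℕ
  weight : PropFormula c

/-- The nested sum `∑_y₁ P(δ₁) * ∑_y₂ P(δ₂) * ⋯ * t`, outermost layer first. -/
def ProbTerm.weighted {c : ℕ} (ls : List (SumLayer c)) (t : ProbTerm c) : ProbTerm c :=
  ls.foldr (fun l s => .sum l.var (.mul (.prob l.weight) s)) t

namespace SumLayer

variable {c : ℕ}

/-- The summation variables of the layers. -/
def vars (ls : List (SumLayer c)) : Set ℕ := {y | ∃ l ∈ ls, l.var = y}

/-- Every weight uses only summation variables in `B` and those of its own and the outer layers. -/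
def AllBoundIn : Set ℕ → List (SumLayer c) → Prop
  | _, [] => True
  | B, l :: ls => l.weight.BoundIn (insert l.var B) ∧ AllBoundIn (insert l.var B) ls

theorem vars_nil : vars ([] : List (SumLayer c)) = ∅ := by
  simp [vars]

theorem vars_cons (l : SumLayer c) (ls : List (SumLayer c)) :
    vars (l :: ls) = insert l.var (vars ls) := by
  ext y
  simp [vars, eq_comm]

theorem vars_append (ls ls' : List (SumLayer c)) : vars (ls ++ ls') = vars ls ∪ vars ls' := by
  ext y
  simp [vars, or_and_right, exists_or]

theorem AllBoundIn.append {ls ls' : List (SumLayer c)} : ∀ {B : Set ℕ},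
    AllBoundIn B ls → AllBoundIn (B ∪ vars ls) ls' → AllBoundIn B (ls ++ ls') := by
  induction ls with
  | nil =>
    intro B _ hls'
    simpa [vars_nil] using hls'
  | cons l ls ih =>
    rintro B ⟨hl, hls⟩ hls'
    rw [vars_cons, Set.union_insert, ← Set.insert_union] at hls'
    exact ⟨hl, ih hls hls'⟩

end SumLayer

namespace ProbTerm

variable {n c : ℕ}

theorem weighted_boundIn {ls : List (SumLayer c)} {t : ProbTerm c} : ∀ {B : Set ℕ},
    SumLayer.AllBoundIn B ls → t.BoundIn (B ∪ SumLayer.vars ls) → (weighted ls t).BoundIn B := by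
  induction ls with
  | nil =>
    intro B _ ht
    simpa [weighted, SumLayer.vars_nil] using ht
  | cons l ls ih =>
    rintro B ⟨hl, hls⟩ ht
    rw [SumLayer.vars_cons, Set.union_insert, ← Set.insert_union] at ht
    exact ⟨hl, ih hls ht⟩

theorem weighted_varsBelow {ls : List (SumLayer c)} {t : ProbTerm c}
    (hls : ∀ l ∈ ls, l.weight.VarsBelow n) (ht : t.VarsBelow n) : (weighted ls t).VarsBelow n := by
  induction ls with
  | nil => exact ht
  | cons l ls ih =>
    rw [List.forall_mem_cons] at hls
    exact ⟨hls.1, ih hls.2⟩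

theorem eval_weighted_cons (𝔐 : SCM n c) (l : SumLayer c) (ls : List (SumLayer c))
    (t : ProbTerm c) (ρ : ℕ → Fin c) :
    (weighted (l :: ls) t).eval 𝔐 ρ = ∑ v : Fin c,
      𝔐.probability (Function.update ρ l.var v) l.weight *
        (weighted ls t).eval 𝔐 (Function.update ρ l.var v) :=
  rfl

end ProbTerm

namespace SCM

variable {n c : ℕ} {𝔐 : SCM n c}

theorem probability_nonneg (𝔐 : SCM n c) (ρ : ℕ → Fin c) (δ : PropFormula c) :
    0 ≤ 𝔐.probability ρ δ :=
  ENNReal.toReal_nonneg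

theorem probability_mono (𝔐 : SCM n c) {ρ ρ' : ℕ → Fin c} {δ δ' : PropFormula c}
    (h : ∀ x : Fin n → Fin c, δ.Holds x ρ → δ'.Holds x ρ') :
    𝔐.probability ρ δ ≤ 𝔐.probability ρ' δ' := by
  have := 𝔐.isProbabilityMeasure
  exact ENNReal.toReal_mono (MeasureTheory.measure_ne_top _ _)
    (MeasureTheory.measure_mono fun u hu => h _ hu)

theorem exists_holds_of_probability_pos {ρ : ℕ → Fin c} {δ : PropFormula c}
    (h : 0 < 𝔐.probability ρ δ) : ∃ x : Fin n → Fin c, δ.Holds x ρ := by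
  by_contra! hnot
  simp [probability, hnot] at h

/-- `ρ'` arises from `ρ` by a choice of values for the summation variables of the layers, outermost
first, that makes all weights positive. Only such choices contribute to the weighted sum. -/
def Path (𝔐 : SCM n c) : List (SumLayer c) → (ℕ → Fin c) → (ℕ → Fin c) → Prop
  | [], ρ, ρ' => ρ' = ρ
  | l :: ls, ρ, ρ' => ∃ v, 0 < 𝔐.probability (Function.update ρ l.var v) l.weight ∧
      𝔐.Path ls (Function.update ρ l.var v) ρ'

theorem path_append {ls ls' : List (SumLayer c)} : ∀ {ρ ρ'' : ℕ → Fin c},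
    𝔐.Path (ls ++ ls') ρ ρ'' ↔ ∃ ρ', 𝔐.Path ls ρ ρ' ∧ 𝔐.Path ls' ρ' ρ'' := by
  induction ls with
  | nil => simp [Path]
  | cons l ls ih =>
    intro ρ ρ''
    simp only [List.cons_append, Path, ih]
    constructor
    · rintro ⟨v, hv, ρ', hρ', hρ''⟩
      exact ⟨ρ', ⟨v, hv, hρ'⟩, hρ''⟩
    · rintro ⟨ρ', ⟨v, hv, hρ'⟩, hρ''⟩
      exact ⟨v, hv, ρ', hρ', hρ''⟩

theorem Path.eq_of_notMem_vars {ls : List (SumLayer c)} : ∀ {ρ ρ' : ℕ → Fin c},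
    𝔐.Path ls ρ ρ' → ∀ {y : ℕ}, y ∉ SumLayer.vars ls → ρ' y = ρ y := by
  induction ls with
  | nil => rintro ρ _ rfl y _; rfl
  | cons l ls ih =>
    rintro ρ ρ' ⟨v, -, hpath⟩ y hy
    rw [SumLayer.vars_cons, Set.mem_insert_iff, not_or] at hy
    rw [ih hpath hy.2, Function.update_of_ne hy.1]

theorem weighted_le_weighted {t t' : ProbTerm c} {ls : List (SumLayer c)} : ∀ {ρ : ℕ → Fin c},
    (∀ ρ', 𝔐.Path ls ρ ρ' → t.eval 𝔐 ρ' ≤ t'.eval 𝔐 ρ') →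
    (ProbTerm.weighted ls t).eval 𝔐 ρ ≤ (ProbTerm.weighted ls t').eval 𝔐 ρ := by
  induction ls with
  | nil => exact fun h => h _ rfl
  | cons l ls ih =>
    intro ρ h
    rw [ProbTerm.eval_weighted_cons, ProbTerm.eval_weighted_cons]
    refine Finset.sum_le_sum fun v _ => ?_
    rcases (𝔐.probability_nonneg (Function.update ρ l.var v) l.weight).eq_or_lt with hv | hv
    · simp [← hv]
    · exact mul_le_mul_of_nonneg_left (ih fun ρ' hρ' => h ρ' ⟨v, hv, hρ'⟩) hv.le

theorem Path.eval_le_of_weighted_le {t t' : ProbTerm c}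
    (hle : ∀ ρ, t'.eval 𝔐 ρ ≤ t.eval 𝔐 ρ) {ls : List (SumLayer c)} : ∀ {ρ ρ' : ℕ → Fin c},
    𝔐.Path ls ρ ρ' →
    (ProbTerm.weighted ls t).eval 𝔐 ρ ≤ (ProbTerm.weighted ls t').eval 𝔐 ρ →
    t.eval 𝔐 ρ' ≤ t'.eval 𝔐 ρ' := by
  induction ls with
  | nil => rintro ρ _ rfl h; exact h
  | cons l ls ih =>
    rintro ρ ρ' ⟨v, hv, hpath⟩ h
    rw [ProbTerm.eval_weighted_cons, ProbTerm.eval_weighted_cons] at h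
    have hterms : ∀ w ∈ Finset.univ,
        𝔐.probability (Function.update ρ l.var w) l.weight *
            (ProbTerm.weighted ls t').eval 𝔐 (Function.update ρ l.var w) ≤
          𝔐.probability (Function.update ρ l.var w) l.weight *
            (ProbTerm.weighted ls t).eval 𝔐 (Function.update ρ l.var w) := fun w _ =>
      mul_le_mul_of_nonneg_left (weighted_le_weighted fun _ _ => hle _) (𝔐.probability_nonneg _ _)
    have hterm_eq := (Finset.sum_eq_sum_iff_of_le hterms).mp
      (le_antisymm (Finset.sum_le_sum hterms) h) v (Finset.mem_univ v)
    exact ih hpath (le_of_mul_le_mul_left hterm_eq.ge hv)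

end SCM

namespace SuccReduction

/-! ## The formula of an instance -/

/-- The value that stands for a truth value. -/
def code {d : ℕ} (b : Bool) : Fin (d + 2) := if b then 1 else 0

theorem code_injective {d : ℕ} : Function.Injective (code (d := d)) := by
  intro a b h
  cases a <;> cases b <;> simp_all [code]

/-- The name of the summation variable for the value of the circuit node `u`. -/
def node (u : ℕ) : ℕ := 8 * u + 7

/-- The name of the summation variable for output `k` of circuit `i < 7`. The random variable
`E_k`, which is compared with output `k` of the circuits, is named `outVar M 7 k`; this is none of
the random variables `X₀, …, X₅`, which have a fixed meaning. -/
def outVar (M i k : ℕ) : ℕ := 8 * (M + k) + i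

theorem node_injective : Function.Injective node := fun u w h => by
  simp only [node] at h
  omega

theorem node_ne_outVar (u M k : ℕ) (i : Fin 7) : node u ≠ outVar M i k := by
  simp only [node, outVar]
  omega

theorem outVar_inj {M k k' : ℕ} {i i' : Fin 7} (h : outVar M i k = outVar M i' k') :
    i = i' ∧ k = k' := by
  simp only [outVar] at h
  exact ⟨Fin.ext (by omega), by omega⟩

section Layers

variable {c : ℕ}

/-- The event that the random variable `X` has the value of the summation variable `y`. -/
def link (X y : ℕ) : PropFormula c := .eq X (.dummy y)

/-- Sums over the values of the input nodes `j, …, j + k - 1`. The random variable `X₀` only takes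
the values that encode truth values. -/
def inputLayers : ℕ → ℕ → List (SumLayer c)
  | _, 0 => []
  | j, k + 1 => ⟨node j, link 0 (node j)⟩ :: inputLayers (j + 1) k

/-- The sum over the value of a gate. The random variables `X₀` and `X₁` are independent truth
values, and `X₂`, `X₃`, `X₄` are the corresponding values of the three kinds of gates: the weight
is positive only if the summation variables obey the truth table. -/
def gateLayer {n : ℕ} : Gate n → SumLayer c
  | .neg u => ⟨node n, .conj (link 2 (node n)) (link 0 (node u))⟩
  | .conj u w => ⟨node n, .conj (link 3 (node n)) (.conj (link 0 (node u)) (link 1 (node w)))⟩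
  | .disj u w => ⟨node n, .conj (link 4 (node n)) (.conj (link 0 (node u)) (link 1 (node w)))⟩

/-- The sums over the values of the gates of a circuit. -/
def gateLayers : {n m : ℕ} → GateList n m → List (SumLayer c)
  | _, _, .nil _ => []
  | _, _, .cons g rest => gateLayer g :: gateLayers rest

/-- Copies the values of the nodes `us` to the summation variables of the outputs `k, k + 1, …` of
circuit `i`. -/
def outLayers (M i : ℕ) : ℕ → List ℕ → List (SumLayer c)
  | _, [] => []
  | k, u :: us =>
    ⟨outVar M i k, .conj (link 0 (outVar M i k)) (link 0 (node u))⟩ :: outLayers M i (k + 1) us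

/-- The sums that evaluate circuit number `i`. -/
def circuitLayers {M N : ℕ} (i : ℕ) (C : Circuit M N) : List (SumLayer c) :=
  gateLayers C.gates ++ outLayers M i 0 (List.ofFn fun k => (C.out k : ℕ))

/-- The sums that evaluate several circuits of an instance on the same input. The circuits share
the summation variables of the nodes, but not those of the outputs. -/
def circuitsLayers (I : SuccInstance) (is : List (Fin 7)) : List (SumLayer c) :=
  (is.map fun i => circuitLayers i.val (I.C i)).flatten

/-- The sums over all inputs that evaluate all circuits of an instance. -/
def layers (I : SuccInstance) : List (SumLayer c) :=
  inputLayers 0 I.M ++ circuitsLayers I (List.finRange 7)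

end Layers

/-- Polynomials with natural coefficients in seven unknowns. These can be written as terms, which
have no subtraction. -/
inductive NatPoly : Type
  | one
  | var (i : Fin 7)
  | add (p q : NatPoly)
  | mul (p q : NatPoly)

namespace NatPoly

/-- The value of a polynomial at a real point. -/
def value (x : Fin 7 → ℝ) : NatPoly → ℝ
  | .one => 1
  | .var i => x i
  | .add p q => p.value x + q.value x
  | .mul p q => p.value x * q.value x

/-- The polynomial `2 p`. -/
def double (p : NatPoly) : NatPoly := .add p p

end NatPoly

/-- With `q = 4 x + 1/2`, the equation `x₁ + x₂ = x₃` says that `2 q₁ + 2 q₂ = 2 q₃ + 1`. This is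
the left-hand side. -/
def sumLeft : NatPoly := (NatPoly.add (.var 1) (.var 2)).double

/-- The right-hand side of `2 q₁ + 2 q₂ = 2 q₃ + 1`. -/
def sumRight : NatPoly := .add (NatPoly.var 3).double .one

/-- With `q = 4 x + 1/2`, the equation `x₄ * x₅ = x₆` says that
`4 q₄ q₅ + 9 = 16 q₆ + 2 (q₄ + q₅)`. This is the left-hand side. -/
def prodLeft : NatPoly :=
  .add (NatPoly.mul (.var 4) (.var 5)).double.double (.add NatPoly.one.double.double.double .one)

/-- The right-hand side of `4 q₄ q₅ + 9 = 16 q₆ + 2 (q₄ + q₅)`. -/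
def prodRight : NatPoly :=
  .add (NatPoly.var 6).double.double.double.double (NatPoly.add (.var 4) (.var 5)).double

/-- The two sides of an inequality `side true ≤ side false`, whose difference is
`(1 - q₀) + (sumLeft - sumRight)² + (prodLeft - prodRight)²`. For `q₀ ≤ 1` it expresses the
three equations of an instance. -/
def side (left : Bool) : NatPoly :=
  if left then
    .add .one (.add (.add (.mul sumLeft sumLeft) (.mul sumRight sumRight))
      (.add (.mul prodLeft prodLeft) (.mul prodRight prodRight)))
  else
    .add (.var 0)
      (.add (NatPoly.mul sumLeft sumRight).double (NatPoly.mul prodLeft prodRight).double)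

theorem side_value_sub (q : Fin 7 → ℝ) :
    (side true).value q - (side false).value q =
      (1 - q 0) + (2 * q 1 + 2 * q 2 - (2 * q 3 + 1)) ^ 2 +
        (4 * (q 4 * q 5) + 9 - (16 * q 6 + 2 * (q 4 + q 5))) ^ 2 := by
  simp only [side, sumLeft, sumRight, prodLeft, prodRight, NatPoly.double, NatPoly.value, if_true,
    Bool.false_eq_true, if_false]
  ring

theorem side_value_mono {q : Fin 7 → ℝ} (hq : q 0 ≤ 1) :
    (side false).value q ≤ (side true).value q := by
  rw [← sub_nonneg, side_value_sub]
  exact add_nonneg (add_nonneg (sub_nonneg.mpr hq) (sq_nonneg _)) (sq_nonneg _)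

theorem side_value_le_iff {x : Fin 7 → ℝ} (hx : x 0 ≤ 1 / 8) :
    ((side true).value (fun i => 4 * x i + 1 / 2) ≤
        (side false).value fun i => 4 * x i + 1 / 2) ↔
      x 0 = 1 / 8 ∧ x 1 + x 2 = x 3 ∧ x 4 * x 5 = x 6 := by
  rw [← sub_nonpos, side_value_sub]
  have hsq := sq_nonneg (x 1 + x 2 - x 3)
  have hsq' := sq_nonneg (x 4 * x 5 - x 6)
  constructor
  · intro h
    refine ⟨le_antisymm hx (by linarith), sub_eq_zero.mp ?_, sub_eq_zero.mp ?_⟩ <;>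
      refine pow_eq_zero_iff two_ne_zero |>.mp (le_antisymm ?_ (sq_nonneg _)) <;> linarith
  · rintro ⟨h₀, h₃, h₆⟩
    rw [h₀, ← h₃, ← h₆]
    exact le_of_eq (by ring)

section Formula

variable {d : ℕ}

/-- An event that never occurs. -/
def falsum : PropFormula (d + 2) := .conj (.eq 0 (.const 0)) (.eq 0 (.const 1))

/-- The event that the random variables `E₀, …, E_{k-1}` have the values that circuit `i` puts
out. -/
def event (M i : ℕ) : ℕ → PropFormula (d + 2)
  | 0 => .neg falsum
  | k + 1 => .conj (link (outVar M 7 k) (outVar M i k)) (event M i k)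

/-- The polynomial at the point whose coordinate `i` is the conditional probability that `X₅ = 0`
when `E₀, …, E_{N-1}` have the values that circuit `i` puts out. -/
def NatPoly.toTerm (M N : ℕ) : NatPoly → ProbTerm (d + 2)
  | .one => .prob (.neg falsum)
  | .var i => .cond (.eq 5 (.const 0)) (event M i N)
  | .add p q => .add (p.toTerm M N) (q.toTerm M N)
  | .mul p q => .mul (p.toTerm M N) (q.toTerm M N)

/-- One row of the truth tables of the three kinds of gates. -/
def tableRow (a b : Bool) : PropFormula (d + 2) :=
  .conj (.eq 0 (.const (code a))) (.conj (.eq 1 (.const (code b)))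
    (.conj (.eq 2 (.const (code !a))) (.conj (.eq 3 (.const (code (a && b))))
      (.eq 4 (.const (code (a || b)))))))

/-- The product of the probabilities of the four rows. -/
def tableProduct : ProbTerm (d + 2) :=
  .mul (.mul (.prob (tableRow false false)) (.prob (tableRow false true)))
    (.mul (.prob (tableRow true false)) (.prob (tableRow true true)))

/-- A side of the inequality, summed over all inputs of the circuits. -/
def sideTerm (I : SuccInstance) (left : Bool) : ProbTerm (d + 2) :=
  ProbTerm.weighted (layers I) ((side left).toTerm I.M I.N)

/-- The reduction: all rows of the truth tables have positive probability, and the weighted sum over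
all inputs of the nonnegative differences of the two sides is at most zero. -/
def formula (d : ℕ) (I : SuccInstance) : ProbFormula (d + 2) :=
  .conj (.neg (.le tableProduct (.prob falsum))) (.le (sideTerm I true) (sideTerm I false))

end Formula

/-! ## The formula is closed -/

section Vars

variable {c : ℕ}

theorem image_Ico_eq_insert {α : Type*} (f : ℕ → α) {a b : ℕ} (hab : a < b) :
    f '' Set.Ico a b = insert (f a) (f '' Set.Ico (a + 1) b) := by
  rw [← Set.image_insert_eq, Set.Ico_add_one_left_eq_Ioo, Set.Ioo_insert_left hab]

theorem vars_inputLayers (k : ℕ) : ∀ j : ℕ,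
    SumLayer.vars (inputLayers (c := c) j k) = node '' Set.Ico j (j + k) := by
  induction k with
  | zero => simp [inputLayers, SumLayer.vars_nil]
  | succ k ih =>
    intro j
    rw [inputLayers, SumLayer.vars_cons, ih, image_Ico_eq_insert node (by omega : j < j + (k + 1)),
      Nat.add_right_comm, Nat.add_assoc]

theorem var_gateLayer {n : ℕ} (g : Gate n) : (gateLayer (c := c) g).var = node n := by
  cases g <;> rfl

theorem le_of_gateList {n m : ℕ} (G : GateList n m) : n ≤ m := by
  induction G with
  | nil => exact le_rfl
  | cons _ _ ih => exact Nat.le_of_succ_le ih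

theorem vars_gateLayers {n m : ℕ} (G : GateList n m) :
    SumLayer.vars (gateLayers (c := c) G) = node '' Set.Ico n m := by
  induction G with
  | nil => simp [gateLayers, SumLayer.vars_nil]
  | cons g rest ih =>
    rw [gateLayers, SumLayer.vars_cons, var_gateLayer, ih,
      image_Ico_eq_insert node (le_of_gateList rest)]

theorem vars_outLayers (M i : ℕ) (us : List ℕ) : ∀ k : ℕ,
    SumLayer.vars (outLayers (c := c) M i k us) = outVar M i '' Set.Ico k (k + us.length) := by
  induction us with
  | nil => simp [outLayers, SumLayer.vars_nil]
  | cons u us ih =>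
    intro k
    rw [outLayers, SumLayer.vars_cons, ih, List.length_cons,
      image_Ico_eq_insert (outVar M i) (by omega : k < k + (us.length + 1)), Nat.add_right_comm,
      Nat.add_assoc]

theorem vars_circuitLayers {M N : ℕ} (i : ℕ) (C : Circuit M N) :
    SumLayer.vars (circuitLayers (c := c) i C) =
      node '' Set.Ico M C.nodes ∪ outVar M i '' Set.Ico 0 N := by
  rw [circuitLayers, SumLayer.vars_append, vars_gateLayers, vars_outLayers, List.length_ofFn,
    Nat.zero_add]

theorem vars_circuitsLayers (I : SuccInstance) (is : List (Fin 7)) :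
    SumLayer.vars (circuitsLayers (c := c) I is) =
      ⋃ i ∈ is, SumLayer.vars (circuitLayers (c := c) i (I.C i)) := by
  induction is with
  | nil => simp [circuitsLayers, SumLayer.vars_nil]
  | cons i is ih =>
    rw [circuitsLayers, List.map_cons, List.flatten_cons, SumLayer.vars_append, ← circuitsLayers,
      ih]
    simp only [List.mem_cons, Set.iUnion_iUnion_eq_or_left]

theorem outVar_mem_vars_layers (I : SuccInstance) (i : Fin 7) {k : ℕ} (hk : k < I.N) :
    outVar I.M i k ∈ SumLayer.vars (layers (c := c) I) := by
  rw [layers, SumLayer.vars_append, vars_circuitsLayers]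
  refine Or.inr (Set.mem_biUnion (List.mem_finRange i) ?_)
  rw [vars_circuitLayers]
  exact Or.inr (Set.mem_image_of_mem _ ⟨Nat.zero_le k, hk⟩)

end Vars

section Closed

variable {c d : ℕ}

theorem link_boundIn {B : Set ℕ} {X y : ℕ} : (link X y : PropFormula c).BoundIn B ↔ y ∈ B :=
  Iff.rfl

theorem inputLayers_allBoundIn (k : ℕ) : ∀ (j : ℕ) (B : Set ℕ),
    SumLayer.AllBoundIn B (inputLayers (c := c) j k) := by
  induction k with
  | zero => exact fun _ _ => trivial
  | succ k ih => exact fun j B => ⟨link_boundIn.mpr (Set.mem_insert _ _), ih _ _⟩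

theorem gateLayer_weight_boundIn {n : ℕ} (g : Gate n) {B : Set ℕ} (hB : ∀ u < n, node u ∈ B) :
    (gateLayer (c := c) g).weight.BoundIn (insert (node n) B) := by
  cases g <;> simp [gateLayer, PropFormula.BoundIn, link_boundIn, hB _ (Fin.is_lt _)]

theorem gateLayers_allBoundIn {n m : ℕ} (G : GateList n m) : ∀ {B : Set ℕ},
    (∀ u < n, node u ∈ B) → SumLayer.AllBoundIn B (gateLayers (c := c) G) := by
  induction G with
  | nil => exact fun _ => trivial
  | @cons n m g rest ih =>
    intro B hB
    rw [gateLayers, SumLayer.AllBoundIn, var_gateLayer]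
    refine ⟨gateLayer_weight_boundIn g hB, ih fun u hu => ?_⟩
    rcases Nat.lt_succ_iff_lt_or_eq.mp hu with hu | rfl
    · exact Set.mem_insert_of_mem _ (hB u hu)
    · exact Set.mem_insert _ _

theorem outLayers_allBoundIn (M i : ℕ) (us : List ℕ) : ∀ (k : ℕ) {B : Set ℕ},
    (∀ u ∈ us, node u ∈ B) → SumLayer.AllBoundIn B (outLayers (c := c) M i k us) := by
  induction us with
  | nil => exact fun _ _ _ => trivial
  | cons u us ih =>
    intro k B hB
    rw [List.forall_mem_cons] at hB
    exact ⟨⟨link_boundIn.mpr (Set.mem_insert _ _),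
        link_boundIn.mpr (Set.mem_insert_of_mem _ hB.1)⟩,
      ih _ fun w hw => Set.mem_insert_of_mem _ (hB.2 w hw)⟩

theorem circuitLayers_allBoundIn {M N : ℕ} (i : ℕ) (C : Circuit M N) {B : Set ℕ}
    (hB : ∀ u < M, node u ∈ B) : SumLayer.AllBoundIn B (circuitLayers (c := c) i C) := by
  refine (gateLayers_allBoundIn C.gates hB).append (outLayers_allBoundIn _ _ _ _ fun u hu => ?_)
  obtain ⟨k, rfl⟩ := (List.mem_ofFn' _ _).mp hu
  rw [vars_gateLayers]
  rcases lt_or_ge (C.out k : ℕ) M with hlt | hge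
  · exact Or.inl (hB _ hlt)
  · exact Or.inr (Set.mem_image_of_mem _ ⟨hge, (C.out k).isLt⟩)

theorem circuitsLayers_allBoundIn (I : SuccInstance) (is : List (Fin 7)) : ∀ {B : Set ℕ},
    (∀ u < I.M, node u ∈ B) → SumLayer.AllBoundIn B (circuitsLayers (c := c) I is) := by
  induction is with
  | nil => exact fun _ => trivial
  | cons i is ih =>
    exact fun hB => (circuitLayers_allBoundIn _ _ hB).append (ih fun u hu => Or.inl (hB u hu))

theorem layers_allBoundIn (I : SuccInstance) : SumLayer.AllBoundIn ∅ (layers (c := c) I) := by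
  refine (inputLayers_allBoundIn _ _ _).append (circuitsLayers_allBoundIn _ _ fun u hu => ?_)
  rw [vars_inputLayers]
  exact Or.inr (Set.mem_image_of_mem _ ⟨Nat.zero_le u, by omega⟩)

theorem falsum_boundIn (B : Set ℕ) : (falsum (d := d)).BoundIn B := ⟨trivial, trivial⟩

theorem event_boundIn {M i : ℕ} {B : Set ℕ} : ∀ {N : ℕ}, (∀ k < N, outVar M i k ∈ B) →
    (event (d := d) M i N).BoundIn B
  | 0, _ => falsum_boundIn B
  | _ + 1, h => ⟨h _ (Nat.lt_succ_self _), event_boundIn fun k hk => h k (Nat.lt_succ_of_lt hk)⟩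

theorem NatPoly.toTerm_boundIn {M N : ℕ} {B : Set ℕ}
    (h : ∀ i : Fin 7, ∀ k < N, outVar M i k ∈ B) (p : NatPoly) :
    (p.toTerm (d := d) M N).BoundIn B := by
  induction p with
  | one => exact falsum_boundIn B
  | var i => exact ⟨trivial, event_boundIn (h i)⟩
  | add p q hp hq => exact ⟨hp, hq⟩
  | mul p q hp hq => exact ⟨hp, hq⟩

theorem sideTerm_boundIn (I : SuccInstance) (left : Bool) :
    (sideTerm (d := d) I left).BoundIn ∅ :=
  ProbTerm.weighted_boundIn (layers_allBoundIn I)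
    ((side left).toTerm_boundIn fun i _ hk => Or.inr (outVar_mem_vars_layers I i hk))

theorem tableRow_boundIn (a b : Bool) (B : Set ℕ) : (tableRow (d := d) a b).BoundIn B :=
  ⟨trivial, trivial, trivial, trivial, trivial⟩

theorem formula_closed (I : SuccInstance) : (formula d I).Closed :=
  ⟨⟨⟨⟨tableRow_boundIn _ _ _, tableRow_boundIn _ _ _⟩,
    tableRow_boundIn _ _ _, tableRow_boundIn _ _ _⟩, falsum_boundIn _⟩,
    sideTerm_boundIn _ _, sideTerm_boundIn _ _⟩

end Closed

/-! ## The random variables of the formula -/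

section VarsBelow

variable {c d n : ℕ}

theorem link_varsBelow {X y : ℕ} : (link X y : PropFormula c).VarsBelow n ↔ X < n :=
  Iff.rfl

theorem inputLayers_varsBelow (hn : 6 ≤ n) (k : ℕ) : ∀ j : ℕ,
    ∀ l ∈ inputLayers (c := c) j k, l.weight.VarsBelow n := by
  induction k with
  | zero => simp [inputLayers]
  | succ k ih =>
    exact fun j => List.forall_mem_cons.mpr ⟨link_varsBelow.mpr (by omega), ih _⟩

theorem gateLayers_varsBelow (hn : 6 ≤ n) {a b : ℕ} (G : GateList a b) :
    ∀ l ∈ gateLayers (c := c) G, l.weight.VarsBelow n := by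
  induction G with
  | nil => simp [gateLayers]
  | cons g rest ih =>
    refine List.forall_mem_cons.mpr ⟨?_, ih⟩
    cases g <;> simp only [gateLayer, PropFormula.VarsBelow, link_varsBelow] <;> omega

theorem outLayers_varsBelow (hn : 6 ≤ n) (M i : ℕ) (us : List ℕ) : ∀ k : ℕ,
    ∀ l ∈ outLayers (c := c) M i k us, l.weight.VarsBelow n := by
  induction us with
  | nil => simp [outLayers]
  | cons u us ih =>
    exact fun k => List.forall_mem_cons.mpr
      ⟨⟨link_varsBelow.mpr (by omega), link_varsBelow.mpr (by omega)⟩, ih _⟩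

theorem layers_varsBelow (hn : 6 ≤ n) (I : SuccInstance) :
    ∀ l ∈ layers (c := c) I, l.weight.VarsBelow n := by
  intro l hl
  rcases List.mem_append.mp hl with hl | hl
  · exact inputLayers_varsBelow hn _ _ l hl
  · simp only [circuitsLayers, List.mem_flatten, List.mem_map] at hl
    obtain ⟨_, ⟨i, -, rfl⟩, hl⟩ := hl
    rcases List.mem_append.mp hl with hl | hl
    · exact gateLayers_varsBelow hn _ l hl
    · exact outLayers_varsBelow hn _ _ _ _ l hl

theorem falsum_varsBelow (hn : 0 < n) : (falsum (d := d)).VarsBelow n := ⟨hn, hn⟩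

theorem event_varsBelow (hn : 0 < n) {M i : ℕ} : ∀ {N : ℕ}, (∀ k < N, outVar M 7 k < n) →
    (event (d := d) M i N).VarsBelow n
  | 0, _ => falsum_varsBelow hn
  | _ + 1, h =>
    ⟨h _ (Nat.lt_succ_self _), event_varsBelow hn fun k hk => h k (Nat.lt_succ_of_lt hk)⟩

theorem NatPoly.toTerm_varsBelow (hn : 6 ≤ n) {M N : ℕ} (h : ∀ k < N, outVar M 7 k < n)
    (p : NatPoly) : (p.toTerm (d := d) M N).VarsBelow n := by
  induction p with
  | one => exact falsum_varsBelow (by omega)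
  | var i => exact ⟨Nat.lt_of_succ_le hn, event_varsBelow (by omega) h⟩
  | add p q hp hq => exact ⟨hp, hq⟩
  | mul p q hp hq => exact ⟨hp, hq⟩

theorem formula_varsBelow (hn : 6 ≤ n) (I : SuccInstance) (h : ∀ k < I.N, outVar I.M 7 k < n) :
    (formula d I).VarsBelow n := by
  have side_varsBelow (left : Bool) : (sideTerm (d := d) I left).VarsBelow n :=
    ProbTerm.weighted_varsBelow (layers_varsBelow hn I) ((side left).toTerm_varsBelow hn h)
  refine ⟨?_, side_varsBelow _, side_varsBelow _⟩
  simp only [ProbFormula.VarsBelow, tableProduct, ProbTerm.VarsBelow, tableRow, falsum,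
    PropFormula.VarsBelow]
  omega

end VarsBelow

/-! ## Paths evaluate the circuits -/

section Paths

variable {n d : ℕ}

/-- Every row of the truth tables has positive probability. -/
def HasRows (𝔐 : SCM n (d + 2)) : Prop :=
  ∀ (ρ : ℕ → Fin (d + 2)) (a b : Bool), 0 < 𝔐.probability ρ (tableRow a b)

/-- Every event of positive probability occurs together with some row of the truth tables. -/
def OnlyRows (𝔐 : SCM n (d + 2)) : Prop :=
  ∀ (ρ : ℕ → Fin (d + 2)) (δ : PropFormula (d + 2)), 0 < 𝔐.probability ρ δ →
    ∃ (x : Fin n → Fin (d + 2)) (a b : Bool), (tableRow a b).Holds x ρ ∧ δ.Holds x ρ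

/-- The summation variables `y 0, …, y (N - 1)` have the values that encode `v`. -/
def Encodes {N : ℕ} (ρ : ℕ → Fin (d + 2)) (y : ℕ → ℕ) (v : Fin N → Bool) : Prop :=
  ∀ k : Fin N, ρ (y k) = code (v k)

variable {𝔐 : SCM n (d + 2)} {x : Fin n → Fin (d + 2)} {ρ ρ' : ℕ → Fin (d + 2)}

theorem tableRow_holds {a b : Bool} :
    (tableRow a b).Holds x ρ ↔ (∃ h : 0 < n, x ⟨0, h⟩ = code a) ∧ (∃ h : 1 < n, x ⟨1, h⟩ = code b) ∧
      (∃ h : 2 < n, x ⟨2, h⟩ = code !a) ∧ (∃ h : 3 < n, x ⟨3, h⟩ = code (a && b)) ∧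
      (∃ h : 4 < n, x ⟨4, h⟩ = code (a || b)) :=
  Iff.rfl

theorem link_holds {X y : ℕ} : (link X y).Holds x ρ ↔ ∃ h : X < n, x ⟨X, h⟩ = ρ y :=
  Iff.rfl

theorem HasRows.probability_pos (hrows : HasRows 𝔐) (a b : Bool) {δ : PropFormula (d + 2)}
    (h : ∀ x : Fin n → Fin (d + 2), (tableRow a b).Holds x ρ → δ.Holds x ρ) :
    0 < 𝔐.probability ρ δ :=
  (hrows ρ a b).trans_le (𝔐.probability_mono h)

theorem HasRows.gateLayer_pos (hrows : HasRows 𝔐) {a : ℕ} {g : Gate a} {v : Fin a → Bool}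
    (hv : Encodes ρ node v) (hg : ρ (node a) = code (g.eval v)) :
    0 < 𝔐.probability ρ (gateLayer g).weight := by
  cases g with
  | neg u =>
    refine hrows.probability_pos (v u) (v u) fun x => ?_
    rw [tableRow_holds, gateLayer, PropFormula.holds_conj, link_holds, link_holds, hv, hg]
    exact fun ⟨h₀, _, h₂, _⟩ => ⟨h₂, h₀⟩
  | conj u w =>
    refine hrows.probability_pos (v u) (v w) fun x => ?_
    rw [tableRow_holds, gateLayer, PropFormula.holds_conj, PropFormula.holds_conj, link_holds,
      link_holds, link_holds, hv, hv, hg]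
    exact fun ⟨h₀, h₁, _, h₃, _⟩ => ⟨h₃, h₀, h₁⟩
  | disj u w =>
    refine hrows.probability_pos (v u) (v w) fun x => ?_
    rw [tableRow_holds, gateLayer, PropFormula.holds_conj, PropFormula.holds_conj, link_holds,
      link_holds, link_holds, hv, hv, hg]
    exact fun ⟨h₀, h₁, _, _, h₄⟩ => ⟨h₄, h₀, h₁⟩

theorem OnlyRows.gateLayer_value (honly : OnlyRows 𝔐) {a : ℕ} {g : Gate a} {v : Fin a → Bool}
    (hv : Encodes ρ node v) (hg : 0 < 𝔐.probability ρ (gateLayer g).weight) :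
    ρ (node a) = code (g.eval v) := by
  obtain ⟨x, p, q, hrow, hx⟩ := honly _ _ hg
  obtain ⟨⟨_, h₀⟩, ⟨_, h₁⟩, ⟨_, h₂⟩, ⟨_, h₃⟩, ⟨_, h₄⟩⟩ := tableRow_holds.mp hrow
  cases g with
  | neg u =>
    rw [gateLayer, PropFormula.holds_conj, link_holds, link_holds, hv] at hx
    obtain ⟨⟨_, hout⟩, _, hu⟩ := hx
    obtain rfl := code_injective (h₀.symm.trans hu)
    exact hout.symm.trans h₂
  | conj u w =>
    rw [gateLayer, PropFormula.holds_conj, PropFormula.holds_conj, link_holds, link_holds,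
      link_holds, hv, hv] at hx
    obtain ⟨⟨_, hout⟩, ⟨_, hu⟩, _, hw⟩ := hx
    obtain rfl := code_injective (h₀.symm.trans hu)
    obtain rfl := code_injective (h₁.symm.trans hw)
    exact hout.symm.trans h₃
  | disj u w =>
    rw [gateLayer, PropFormula.holds_conj, PropFormula.holds_conj, link_holds, link_holds,
      link_holds, hv, hv] at hx
    obtain ⟨⟨_, hout⟩, ⟨_, hu⟩, _, hw⟩ := hx
    obtain rfl := code_injective (h₀.symm.trans hu)
    obtain rfl := code_injective (h₁.symm.trans hw)
    exact hout.symm.trans h₄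

theorem Encodes.update_node {a : ℕ} {v : Fin a → Bool} (hv : Encodes ρ node v)
    (z : Fin (d + 2)) : Encodes (Function.update ρ (node a) z) node v := fun u => by
  rw [Function.update_of_ne (node_injective.ne u.isLt.ne), hv]

theorem Encodes.snoc {a : ℕ} {v : Fin a → Bool} (hv : Encodes ρ node v) (b : Bool) :
    Encodes (Function.update ρ (node a) (code b)) node (Fin.snoc (α := fun _ => Bool) v b) := by
  refine Fin.lastCases ?_ fun u => ?_
  · rw [Fin.snoc_last, Fin.val_last, Function.update_self]
  · rw [Fin.snoc_castSucc]
    exact hv.update_node _ u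

theorem HasRows.exists_path_gateLayers (hrows : HasRows 𝔐) {a m : ℕ} (G : GateList a m) :
    ∀ {v : Fin a → Bool} {ρ : ℕ → Fin (d + 2)}, Encodes ρ node v →
      ∃ ρ', 𝔐.Path (gateLayers G) ρ ρ' ∧ Encodes ρ' node (G.eval v) := by
  induction G with
  | nil => exact fun hv => ⟨_, rfl, hv⟩
  | cons g rest ih =>
    intro v ρ hv
    obtain ⟨ρ', hpath, hvalues⟩ := ih (hv.snoc (g.eval v))
    refine ⟨ρ', ⟨code (g.eval v), ?_, ?_⟩, hvalues⟩ <;> rw [var_gateLayer]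
    · exact hrows.gateLayer_pos (hv.update_node _) (Function.update_self _ _ _)
    · exact hpath

theorem OnlyRows.gateLayers_value (honly : OnlyRows 𝔐) {a m : ℕ} (G : GateList a m) :
    ∀ {v : Fin a → Bool} {ρ ρ' : ℕ → Fin (d + 2)}, Encodes ρ node v →
      𝔐.Path (gateLayers G) ρ ρ' → Encodes ρ' node (G.eval v) := by
  induction G with
  | nil => rintro v ρ _ hv rfl; exact hv
  | cons g rest ih =>
    rintro v ρ ρ' hv ⟨z, hpos, hpath⟩
    rw [var_gateLayer] at hpos hpath
    have hz := honly.gateLayer_value (hv.update_node z) hpos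
    rw [Function.update_self] at hz
    subst hz
    exact ih (hv.snoc _) hpath

theorem HasRows.exists_path_outLayers (hrows : HasRows 𝔐) (M : ℕ) (i : Fin 7) (us : List ℕ) :
    ∀ (k : ℕ) {ρ : ℕ → Fin (d + 2)}, (∀ u ∈ us, ∃ b, ρ (node u) = code b) →
      ∃ ρ', 𝔐.Path (outLayers M i k us) ρ ρ' := by
  induction us with
  | nil => exact fun k ρ _ => ⟨ρ, rfl⟩
  | cons u us ih =>
    intro k ρ hcoded
    obtain ⟨⟨b, hb⟩, hcoded⟩ := List.forall_mem_cons.mp hcoded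
    obtain ⟨ρ', hpath⟩ := ih (k + 1) (ρ := Function.update ρ (outVar M i k) (code b)) fun w hw => by
      rw [Function.update_of_ne (node_ne_outVar _ _ _ _)]
      exact hcoded w hw
    refine ⟨ρ', code b, hrows.probability_pos b b fun x => ?_, hpath⟩
    rw [PropFormula.holds_conj, link_holds, link_holds, Function.update_self,
      Function.update_of_ne (node_ne_outVar _ _ _ _), hb]
    exact fun hrow => ⟨hrow.1, hrow.1⟩

theorem outLayers_value {M : ℕ} {i : Fin 7} {us : List ℕ} :
    ∀ {k : ℕ} {ρ ρ' : ℕ → Fin (d + 2)}, 𝔐.Path (outLayers M i k us) ρ ρ' →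
      ∀ (t : ℕ) (ht : t < us.length), ρ' (outVar M i (k + t)) = ρ (node us[t]) := by
  induction us with
  | nil => intro k ρ ρ' _ t ht; simp at ht
  | cons u us ih =>
    rintro k ρ ρ' ⟨z, hpos, hpath⟩ t ht
    cases t with
    | zero =>
      obtain ⟨x, hx⟩ := SCM.exists_holds_of_probability_pos hpos
      rw [PropFormula.holds_conj, link_holds, link_holds,
        Function.update_of_ne (node_ne_outVar _ _ _ _)] at hx
      obtain ⟨⟨_, hout⟩, _, hnode⟩ := hx
      rw [hpath.eq_of_notMem_vars]
      · exact hout.symm.trans hnode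
      · rw [vars_outLayers]
        rintro ⟨k', hk', heq⟩
        have := (outVar_inj heq).2
        simp only [Set.mem_Ico] at hk'
        omega
    | succ t =>
      have := ih hpath t (Nat.lt_of_succ_lt_succ ht)
      rwa [Function.update_of_ne (node_ne_outVar _ _ _ _), Nat.add_right_comm,
        Nat.add_assoc] at this

theorem outLayers_encodes {M N m : ℕ} {i : Fin 7} {out : Fin N → Fin m} {w : Fin m → Bool}
    (hw : Encodes ρ node w)
    (hpath : 𝔐.Path (outLayers M i 0 (List.ofFn fun k => (out k : ℕ))) ρ ρ') :
    Encodes ρ' (outVar M i) fun k => w (out k) := fun k => by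
  have := outLayers_value hpath k (by simp)
  rwa [Nat.zero_add, List.getElem_ofFn, hw] at this

theorem HasRows.exists_path_circuitLayers (hrows : HasRows 𝔐) {M N : ℕ} (i : Fin 7)
    (C : Circuit M N) {j : Fin M → Bool} (hj : Encodes ρ node j) :
    ∃ ρ', 𝔐.Path (circuitLayers i C) ρ ρ' ∧ Encodes ρ' (outVar M i) (C.eval j) := by
  obtain ⟨ρ₁, hgates, hvalues⟩ := hrows.exists_path_gateLayers C.gates hj
  obtain ⟨ρ', houts⟩ := hrows.exists_path_outLayers M i (List.ofFn fun k => (C.out k : ℕ)) 0 <| by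
    intro u hu
    obtain ⟨k, rfl⟩ := (List.mem_ofFn' _ _).mp hu
    exact ⟨_, hvalues _⟩
  exact ⟨ρ', SCM.path_append.mpr ⟨ρ₁, hgates, houts⟩,
    outLayers_encodes (out := C.out) hvalues houts⟩

theorem OnlyRows.circuitLayers_value (honly : OnlyRows 𝔐) {M N : ℕ} {i : Fin 7}
    {C : Circuit M N} {j : Fin M → Bool} (hj : Encodes ρ node j)
    (hpath : 𝔐.Path (circuitLayers i C) ρ ρ') : Encodes ρ' (outVar M i) (C.eval j) := by
  obtain ⟨ρ₁, hgates, houts⟩ := SCM.path_append.mp hpath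
  exact outLayers_encodes (out := C.out) (honly.gateLayers_value C.gates hj hgates) houts

theorem Encodes.path_circuitLayers {M N : ℕ} {i : Fin 7} {C : Circuit M N} {j : Fin M → Bool}
    (hj : Encodes ρ node j) (hpath : 𝔐.Path (circuitLayers i C) ρ ρ') : Encodes ρ' node j := by
  intro u
  rw [hpath.eq_of_notMem_vars, hj]
  rw [vars_circuitLayers]
  rintro (⟨w, hw, heq⟩ | ⟨k, -, heq⟩)
  · exact u.isLt.not_ge (node_injective heq ▸ hw.1)
  · exact node_ne_outVar _ _ _ _ heq.symm

theorem Encodes.path_circuitsLayers {I : SuccInstance} {is : List (Fin 7)} {i : Fin 7}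
    (hi : i ∉ is) {v : Fin I.N → Bool} (hv : Encodes ρ (outVar I.M i) v)
    (hpath : 𝔐.Path (circuitsLayers I is) ρ ρ') : Encodes ρ' (outVar I.M i) v := by
  intro k
  rw [hpath.eq_of_notMem_vars, hv]
  rw [vars_circuitsLayers, Set.mem_iUnion₂]
  rintro ⟨i', hi', hmem⟩
  rw [vars_circuitLayers] at hmem
  rcases hmem with ⟨u, -, heq⟩ | ⟨k', -, heq⟩
  · exact node_ne_outVar _ _ _ _ heq
  · exact hi ((outVar_inj heq).1 ▸ hi')

theorem HasRows.exists_path_circuitsLayers (hrows : HasRows 𝔐) (I : SuccInstance)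
    {j : Fin I.M → Bool} {is : List (Fin 7)} (his : is.Nodup) :
    ∀ {ρ : ℕ → Fin (d + 2)}, Encodes ρ node j →
      ∃ ρ', 𝔐.Path (circuitsLayers I is) ρ ρ' ∧
        ∀ i ∈ is, Encodes ρ' (outVar I.M i) ((I.C i).eval j) := by
  induction is with
  | nil => exact fun _ => ⟨_, rfl, by simp⟩
  | cons i is ih =>
    intro ρ hj
    obtain ⟨hi, his⟩ := List.nodup_cons.mp his
    obtain ⟨ρ₁, hpath₁, hout⟩ := hrows.exists_path_circuitLayers i (I.C i) hj
    obtain ⟨ρ', hpath, houts⟩ := ih his (hj.path_circuitLayers hpath₁)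
    exact ⟨ρ', SCM.path_append.mpr ⟨ρ₁, hpath₁, hpath⟩,
      List.forall_mem_cons.mpr ⟨hout.path_circuitsLayers hi hpath, houts⟩⟩

theorem OnlyRows.circuitsLayers_value (honly : OnlyRows 𝔐) {I : SuccInstance}
    {j : Fin I.M → Bool} {is : List (Fin 7)} (his : is.Nodup) :
    ∀ {ρ ρ' : ℕ → Fin (d + 2)}, Encodes ρ node j → 𝔐.Path (circuitsLayers I is) ρ ρ' →
      ∀ i ∈ is, Encodes ρ' (outVar I.M i) ((I.C i).eval j) := by
  induction is with
  | nil => simp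
  | cons i is ih =>
    intro ρ ρ' hj hpath
    obtain ⟨hi, his⟩ := List.nodup_cons.mp his
    obtain ⟨ρ₁, hpath₁, hpath⟩ := SCM.path_append.mp hpath
    exact List.forall_mem_cons.mpr
      ⟨(honly.circuitLayers_value hj hpath₁).path_circuitsLayers hi hpath,
        ih his (hj.path_circuitLayers hpath₁) hpath⟩

theorem inputLayers_node {j k u : ℕ} (hu : u < j) (hpath : 𝔐.Path (inputLayers j k) ρ ρ') :
    ρ' (node u) = ρ (node u) := by
  refine hpath.eq_of_notMem_vars ?_
  rw [vars_inputLayers]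
  rintro ⟨w, hw, heq⟩
  exact hu.not_ge (node_injective heq ▸ hw.1)

theorem HasRows.exists_path_inputLayers (hrows : HasRows 𝔐) (b : ℕ → Bool) (k : ℕ) :
    ∀ (j : ℕ) (ρ : ℕ → Fin (d + 2)), ∃ ρ', 𝔐.Path (inputLayers j k) ρ ρ' ∧
      ∀ u, j ≤ u → u < j + k → ρ' (node u) = code (b u) := by
  induction k with
  | zero => exact fun j ρ => ⟨ρ, rfl, by omega⟩
  | succ k ih =>
    intro j ρ
    obtain ⟨ρ', hpath, hvalues⟩ := ih (j + 1) (Function.update ρ (node j) (code (b j)))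
    refine ⟨ρ', ⟨code (b j), hrows.probability_pos (b j) (b j) fun x hrow => ?_, hpath⟩,
      fun u hju huk => ?_⟩
    · rw [link_holds, Function.update_self]
      exact hrow.1
    · rcases hju.eq_or_lt with rfl | hju
      · rw [inputLayers_node (Nat.lt_succ_self _) hpath, Function.update_self]
      · exact hvalues u hju (by omega)

theorem OnlyRows.inputLayers_value (honly : OnlyRows 𝔐) {k : ℕ} :
    ∀ {j : ℕ} {ρ ρ' : ℕ → Fin (d + 2)}, 𝔐.Path (inputLayers j k) ρ ρ' →
      ∀ u, j ≤ u → u < j + k → ∃ b, ρ' (node u) = code b := by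
  induction k with
  | zero => intros; omega
  | succ k ih =>
    rintro j ρ ρ' ⟨z, hpos, hpath⟩ u hju huk
    rcases hju.eq_or_lt with rfl | hju
    · obtain ⟨x, a, _, ⟨⟨_, hrow⟩, -⟩, _, hlink⟩ := honly _ _ hpos
      rw [inputLayers_node (Nat.lt_succ_self _) hpath]
      exact ⟨a, hlink.symm.trans hrow⟩
    · exact ih hpath u hju (by omega)

theorem HasRows.exists_path_layers (hrows : HasRows 𝔐) (I : SuccInstance) (j : Fin I.M → Bool)
    (ρ : ℕ → Fin (d + 2)) : ∃ ρ', 𝔐.Path (layers I) ρ ρ' ∧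
      ∀ i : Fin 7, Encodes ρ' (outVar I.M i) ((I.C i).eval j) := by
  obtain ⟨ρ₁, hinput, hvalues⟩ := hrows.exists_path_inputLayers
    (fun u => if h : u < I.M then j ⟨u, h⟩ else false) I.M 0 ρ
  have hj : Encodes ρ₁ node j := fun u => by
    rw [hvalues u (Nat.zero_le _) (by omega), dif_pos u.isLt]
  obtain ⟨ρ', hcircuits, houts⟩ := hrows.exists_path_circuitsLayers I (List.nodup_finRange 7) hj
  exact ⟨ρ', SCM.path_append.mpr ⟨ρ₁, hinput, hcircuits⟩, fun i => houts i (List.mem_finRange i)⟩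

theorem OnlyRows.layers_value (honly : OnlyRows 𝔐) {I : SuccInstance}
    (hpath : 𝔐.Path (layers I) ρ ρ') : ∃ j : Fin I.M → Bool,
      ∀ i : Fin 7, Encodes ρ' (outVar I.M i) ((I.C i).eval j) := by
  obtain ⟨ρ₁, hinput, hcircuits⟩ := SCM.path_append.mp hpath
  choose j hj using fun u : Fin I.M =>
    honly.inputLayers_value hinput u (Nat.zero_le _) (by omega)
  exact ⟨j, fun i =>
    honly.circuitsLayers_value (List.nodup_finRange 7) hj hcircuits i (List.mem_finRange i)⟩

end Paths

/-! ## The values of the two sides -/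

section Sides

variable {n d : ℕ} (𝔐 : SCM n (d + 2)) {x : Fin n → Fin (d + 2)} {ρ : ℕ → Fin (d + 2)}

theorem not_falsum_holds : ¬ falsum.Holds x ρ := by
  rintro ⟨⟨_, h⟩, _, h'⟩
  simp [h, ValTerm.eval] at h'

theorem probability_falsum : 𝔐.probability ρ falsum = 0 := by
  simp [SCM.probability, not_falsum_holds]

theorem probability_neg_falsum : 𝔐.probability ρ (.neg falsum) = 1 := by
  have := 𝔐.isProbabilityMeasure
  have hverum (x : Fin n → Fin (d + 2)) : (PropFormula.neg falsum).Holds x ρ := not_falsum_holds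
  simp [SCM.probability, hverum]

theorem event_holds {M i N : ℕ} : (event M i N).Holds x ρ ↔
    ∀ k < N, ∃ h : outVar M 7 k < n, x ⟨outVar M 7 k, h⟩ = ρ (outVar M i k) := by
  induction N with
  | zero =>
    simp only [event, Nat.not_lt_zero, false_implies, implies_true, iff_true]
    exact not_falsum_holds
  | succ N ih =>
    rw [event, PropFormula.holds_conj, ih, link_holds, Nat.forall_lt_succ_right, and_comm]

/-- The event that the random variables `E_k` encode `e`. -/
def OutputEvent {N : ℕ} (M : ℕ) (e : Fin N → Bool) (x : Fin n → Fin (d + 2)) : Prop :=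
  ∀ k : Fin N, ∃ h : outVar M 7 k < n, x ⟨outVar M 7 k, h⟩ = code (e k)

theorem Encodes.event_holds_iff {M N i : ℕ} {e : Fin N → Bool} (he : Encodes ρ (outVar M i) e) :
    (event M i N).Holds x ρ ↔ OutputEvent M e x := by
  simp only [event_holds, OutputEvent, ← he _, Fin.forall_iff]

/-- The conditional probability that represents the real variable `x_e`: that of `X₅ = 0` when the
random variables `E_k` encode `e`. -/
noncomputable def condProb {N : ℕ} (M : ℕ) (e : Fin N → Bool) : ℝ :=
  (𝔐.P {u | (∃ h : 5 < n, 𝔐.value u ⟨5, h⟩ = 0) ∧ OutputEvent M e (𝔐.value u)}).toReal /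
    (𝔐.P {u | OutputEvent M e (𝔐.value u)}).toReal

theorem condProb_nonneg {N : ℕ} (M : ℕ) (e : Fin N → Bool) : 0 ≤ condProb 𝔐 M e :=
  div_nonneg ENNReal.toReal_nonneg ENNReal.toReal_nonneg

theorem condProb_le_one {N : ℕ} (M : ℕ) (e : Fin N → Bool) : condProb 𝔐 M e ≤ 1 := by
  have := 𝔐.isProbabilityMeasure
  exact div_le_one_of_le₀ (ENNReal.toReal_mono (MeasureTheory.measure_ne_top _ _)
    (MeasureTheory.measure_mono fun u hu => hu.2)) ENNReal.toReal_nonneg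

theorem eval_cond_le_one (δ δ' : PropFormula (d + 2)) :
    (ProbTerm.cond δ δ').eval 𝔐 ρ ≤ 1 :=
  div_le_one_of_le₀ (𝔐.probability_mono fun _ h => h.2) (𝔐.probability_nonneg _ _)

theorem NatPoly.toTerm_eval {M N : ℕ} (p : NatPoly) : (p.toTerm M N).eval 𝔐 ρ =
    p.value fun i => ((NatPoly.var i).toTerm M N).eval 𝔐 ρ := by
  induction p with
  | one => exact probability_neg_falsum 𝔐
  | var i => rfl
  | add p q hp hq => exact congrArg₂ (· + ·) hp hq
  | mul p q hp hq => exact congrArg₂ (· * ·) hp hq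

theorem NatPoly.toTerm_eval_of_encodes {M N : ℕ} {e : Fin 7 → Fin N → Bool}
    (he : ∀ i : Fin 7, Encodes ρ (outVar M i) (e i)) (p : NatPoly) :
    (p.toTerm M N).eval 𝔐 ρ = p.value fun i => condProb 𝔐 M (e i) := by
  rw [NatPoly.toTerm_eval]
  congr 1
  funext i
  simp only [NatPoly.toTerm, ProbTerm.eval, SCM.probability, PropFormula.holds_conj,
    (he i).event_holds_iff]
  rfl

theorem side_false_eval_le (M N : ℕ) (ρ : ℕ → Fin (d + 2)) :
    ((side false).toTerm M N).eval 𝔐 ρ ≤ ((side true).toTerm M N).eval 𝔐 ρ := by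
  rw [NatPoly.toTerm_eval, NatPoly.toTerm_eval _ (side true)]
  exact side_value_mono (eval_cond_le_one 𝔐 _ _)

theorem tableProduct_pos_iff :
    ¬ tableProduct.eval 𝔐 ρ ≤ (ProbTerm.prob falsum).eval 𝔐 ρ ↔ HasRows 𝔐 := by
  simp only [tableProduct, ProbTerm.eval, probability_falsum, not_le]
  constructor
  · -- `tableRow` has no summation variables, so that its probability does not depend on `ρ`.
    intro hprod ρ' a b
    change 0 < 𝔐.probability ρ (tableRow a b)
    refine (𝔐.probability_nonneg _ _).lt_of_ne fun hzero => hprod.ne' ?_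
    cases a <;> cases b <;> simp [← hzero]
  · intro hrows
    exact mul_pos (mul_pos (hrows _ _ _) (hrows _ _ _)) (mul_pos (hrows _ _ _) (hrows _ _ _))

end Sides

/-! ## From a model to a solution -/

theorem mem_succETR_of_models {n d : ℕ} {I : SuccInstance} {𝔐 : SCM n (d + 2)}
    (h : 𝔐.Models (formula d I)) : I ∈ SuccETR (1 / 8) (-(1 / 8)) (1 / 8) := by
  obtain ⟨hprod, hsum⟩ := h 0
  have hrows : HasRows 𝔐 := (tableProduct_pos_iff 𝔐).mp hprod
  let x (e : Fin I.N → Bool) : ℝ := (condProb 𝔐 I.M e - 1 / 2) / 4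
  have condProb_eq (e) : condProb 𝔐 I.M e = 4 * x e + 1 / 2 := by simp only [x]; ring
  have hx (e) : x e ∈ Set.Icc (-(1 / 8)) (1 / 8 : ℝ) := by
    have hnonneg := condProb_nonneg 𝔐 I.M e
    have hle := condProb_le_one 𝔐 I.M e
    constructor <;> simp only [x] <;> linarith
  refine ⟨x, hx, fun j => ?_⟩
  obtain ⟨ρ, hpath, hρ⟩ := hrows.exists_path_layers I j 0
  have hside := hpath.eval_le_of_weighted_le (side_false_eval_le 𝔐 I.M I.N) hsum
  simp only [NatPoly.toTerm_eval_of_encodes 𝔐 hρ, condProb_eq] at hside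
  exact (side_value_le_iff (x := fun i => x ((I.C i).eval j)) (hx _).2).mp hside

end SuccReduction

/-! ## Models with a finite sample space -/

namespace SCM

variable {n c : ℕ} {Ω : Type} [Fintype Ω] {w : Ω → ℝ}

open MeasureTheory in
/-- The model whose endogenous variables are the random variables `X` on the finite sample space
`Ω`, where the probability of `ω` is `w ω`. Its only exogenous variable is the point of `Ω`. -/
noncomputable def ofWeights (hw : w ∈ stdSimplex ℝ Ω) (X : Ω → Fin n → Fin c) : SCM n c where
  Exo := Unit
  Dom _ := Ω
  measurableSpace _ := ⊤
  P := letI : MeasurableSpace Ω := ⊤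
    ∑ ω, ENNReal.ofReal (w ω) • Measure.dirac fun _ => ω
  isProbabilityMeasure := by
    let _ : MeasurableSpace Ω := ⊤
    refine ⟨?_⟩
    simp [← ENNReal.ofReal_sum_of_nonneg fun ω _ => hw.1 ω, hw.2]
  F i _ u := X (u ()) i
  measurable_F i _ :=
    letI : MeasurableSpace Ω := ⊤
    (measurable_from_top (f := fun ω => X ω i)).comp (measurable_pi_apply ())

theorem ofWeights_value (hw : w ∈ stdSimplex ℝ Ω) (X : Ω → Fin n → Fin c)
    (u : ∀ k, (ofWeights hw X).Dom k) : (ofWeights hw X).value u = X (u ()) := by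
  funext i
  rw [SCM.value]
  rfl

open Classical in
theorem ofWeights_measure (hw : w ∈ stdSimplex ℝ Ω) (X : Ω → Fin n → Fin c)
    (A : (Fin n → Fin c) → Prop) :
    ((ofWeights hw X).P {u | A ((ofWeights hw X).value u)}).toReal =
      ∑ ω, if A (X ω) then w ω else 0 := by
  let _ : MeasurableSpace Ω := ⊤
  have : MeasurableSingletonClass Ω := ⟨fun _ => MeasurableSpace.measurableSet_top⟩
  have dirac_apply (ω : Ω) :
      MeasureTheory.Measure.dirac (fun _ : Unit => ω) {u | A (X (u ()))} =
        if A (X ω) then 1 else 0 := by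
    simp [MeasureTheory.Measure.dirac_apply, Set.indicator_apply]
  rw [funext (ofWeights_value hw X)]
  change ((∑ ω, ENNReal.ofReal (w ω) • MeasureTheory.Measure.dirac fun _ : Unit => ω)
    {u | A (X (u ()))}).toReal = _
  simp only [MeasureTheory.Measure.finsetSum_apply, MeasureTheory.Measure.smul_apply, dirac_apply,
    smul_eq_mul, mul_ite, mul_one, mul_zero]
  rw [ENNReal.toReal_sum fun ω _ => by split_ifs <;> simp]
  exact Finset.sum_congr rfl fun ω _ => by split_ifs <;> simp [hw.1 ω]

end SCM

namespace SuccReduction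

/-! ## From a solution to a model -/

section Sample

variable {d M n N : ℕ}

/-- The sample space: two inputs of a gate, an output of a circuit, and a biased bit. -/
abbrev Sample (N : ℕ) : Type := (Bool × Bool) × (Fin N → Bool) × Bool

/-- The value of the random variable `X` at a sample point. The random variables are `X₀, …, X₅`
and `E_k`, whose name is `outVar M 7 k = 8 * (M + k) + 7`. -/
def sampleValue (M : ℕ) (ω : Sample N) : ℕ → Fin (d + 2)
  | 0 => code ω.1.1
  | 1 => code ω.1.2
  | 2 => code !ω.1.1
  | 3 => code (ω.1.1 && ω.1.2)
  | 4 => code (ω.1.1 || ω.1.2)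
  | 5 => code ω.2.2
  | X + 6 => if h : (X + 6) / 8 - M < N then code (ω.2.1 ⟨(X + 6) / 8 - M, h⟩) else 0

theorem sampleValue_outVar (M : ℕ) (ω : Sample N) (k : Fin N) :
    sampleValue (d := d) M ω (outVar M 7 k) = code (ω.2.1 k) := by
  have hk : (8 * (M + k) + 1 + 6) / 8 - M = k := by omega
  change sampleValue M ω (8 * (M + k) + 1 + 6) = _
  simp only [sampleValue, hk, k.isLt, dif_pos]

/-- The values of all random variables at a sample point. -/
def sampleVector (d M n : ℕ) (ω : Sample N) : Fin n → Fin (d + 2) :=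
  fun i => sampleValue M ω i

theorem sampleVector_tableRow (hn : 6 ≤ n) (ω : Sample N) (ρ : ℕ → Fin (d + 2)) :
    (tableRow ω.1.1 ω.1.2).Holds (sampleVector d M n ω) ρ :=
  tableRow_holds.mpr ⟨⟨by omega, rfl⟩, ⟨by omega, rfl⟩, ⟨by omega, rfl⟩, ⟨by omega, rfl⟩,
    ⟨by omega, rfl⟩⟩

theorem outputEvent_sampleVector (hn : outVar M 7 N ≤ n) (e : Fin N → Bool) (ω : Sample N) :
    OutputEvent M e (sampleVector d M n ω) ↔ ω.2.1 = e := by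
  have hlt (k : Fin N) : outVar M 7 k < n := by
    simp only [outVar] at hn ⊢
    omega
  simp only [OutputEvent, sampleVector, sampleValue_outVar, exists_prop, hlt, true_and,
    code_injective.eq_iff]
  exact funext_iff.symm

theorem sampleVector_five (hn : 6 ≤ n) (ω : Sample N) :
    (∃ h : 5 < n, sampleVector d M n ω ⟨5, h⟩ = 0) ↔ ω.2.2 = false := by
  rw [exists_prop_of_true (by omega)]
  exact code_injective.eq_iff (b := false)

/-- The probability of a sample point: the bit is `0` with probability `q e` if the output is `e`,
everything else is uniform. -/
noncomputable def sampleWeight (q : (Fin N → Bool) → ℝ) (ω : Sample N) : ℝ :=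
  (4 * 2 ^ N)⁻¹ * if ω.2.2 then 1 - q ω.2.1 else q ω.2.1

variable {q : (Fin N → Bool) → ℝ}

theorem sampleWeight_nonneg (hq : ∀ e, q e ∈ Set.Icc (0 : ℝ) 1) (ω : Sample N) :
    0 ≤ sampleWeight q ω := by
  refine mul_nonneg (by positivity) ?_
  split_ifs
  · exact sub_nonneg.mpr (hq ω.2.1).2
  · exact (hq ω.2.1).1

theorem sum_sampleWeight_ite (A : (Fin N → Bool) → Bool → Prop) [∀ e b, Decidable (A e b)] :
    (∑ ω : Sample N, if A ω.2.1 ω.2.2 then sampleWeight q ω else 0) =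
      (2 ^ N)⁻¹ * ∑ e, ((if A e true then 1 - q e else 0) + if A e false then q e else 0) := by
  simp only [Fintype.sum_prod_type, sampleWeight, Fintype.sum_bool, Finset.mul_sum,
    ← Finset.sum_add_distrib]
  refine Finset.sum_congr rfl fun e _ => ?_
  by_cases htrue : A e true <;> by_cases hfalse : A e false <;> simp [htrue, hfalse] <;>
    field_simp <;> ring

theorem sampleWeight_mem_stdSimplex (hq : ∀ e, q e ∈ Set.Icc (0 : ℝ) 1) :
    sampleWeight q ∈ stdSimplex ℝ (Sample N) := by
  refine ⟨sampleWeight_nonneg hq, ?_⟩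
  have := sum_sampleWeight_ite (q := q) fun _ _ => True
  simpa using this

/-- The model in which the conditional probability that represents `x_e` is `q e`. -/
noncomputable def sampleModel (d M n : ℕ) (hq : ∀ e, q e ∈ Set.Icc (0 : ℝ) 1) : SCM n (d + 2) :=
  SCM.ofWeights (sampleWeight_mem_stdSimplex hq) (sampleVector d M n)

variable (hq : ∀ e, q e ∈ Set.Icc (0 : ℝ) 1)

open Classical in
theorem sampleModel_probability (ρ : ℕ → Fin (d + 2)) (δ : PropFormula (d + 2)) :
    (sampleModel d M n hq).probability ρ δ =
      ∑ ω : Sample N, if δ.Holds (sampleVector d M n ω) ρ then sampleWeight q ω else 0 :=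
  SCM.ofWeights_measure _ _ fun x => δ.Holds x ρ

theorem sampleModel_onlyRows (hn : 6 ≤ n) : OnlyRows (sampleModel d M n hq) := by
  classical
  intro ρ δ hδ
  rw [sampleModel_probability] at hδ
  obtain ⟨ω, -, hω⟩ := Finset.exists_ne_zero_of_sum_ne_zero hδ.ne'
  exact ⟨_, _, _, sampleVector_tableRow hn ω ρ, (ite_ne_right_iff.mp hω).1⟩

theorem sampleModel_hasRows (hn : 6 ≤ n) : HasRows (sampleModel d M n hq) := by
  intro ρ a b
  obtain ⟨z, hz⟩ : ∃ z : Bool, 0 < if z then 1 - q (fun _ => false) else q fun _ => false := by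
    rcases (hq fun _ => false).1.eq_or_lt with hzero | hpos
    · exact ⟨true, by simp [← hzero]⟩
    · exact ⟨false, by simpa using hpos⟩
  rw [sampleModel_probability]
  refine Finset.sum_pos' (fun ω _ => ?_) ⟨((a, b), (fun _ => false), z), Finset.mem_univ _, ?_⟩
  · split_ifs
    · exact sampleWeight_nonneg hq ω
    · exact le_rfl
  · rw [if_pos (sampleVector_tableRow hn ((a, b), (fun _ : Fin N => false), z) ρ)]
    exact mul_pos (by positivity) hz

theorem condProb_sampleModel (hn : outVar M 7 N ≤ n) (e : Fin N → Bool) :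
    condProb (sampleModel d M n hq) M e = q e := by
  classical
  have hn6 : 6 ≤ n := by simp only [outVar] at hn; omega
  have houtput : ((sampleModel d M n hq).P
      {u | OutputEvent M e ((sampleModel d M n hq).value u)}).toReal = (2 ^ N)⁻¹ := by
    rw [sampleModel, SCM.ofWeights_measure]
    simp only [outputEvent_sampleVector hn]
    simp [sum_sampleWeight_ite fun e' _ => e' = e, Finset.sum_add_distrib]
  have hbit : ((sampleModel d M n hq).P
      {u | (∃ h : 5 < n, (sampleModel d M n hq).value u ⟨5, h⟩ = 0) ∧
        OutputEvent M e ((sampleModel d M n hq).value u)}).toReal = (2 ^ N)⁻¹ * q e := by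
    rw [sampleModel, SCM.ofWeights_measure _ _ fun x => (∃ h : 5 < n, x ⟨5, h⟩ = 0) ∧
      OutputEvent M e x]
    simp only [outputEvent_sampleVector hn, sampleVector_five hn6]
    simp [sum_sampleWeight_ite fun e' b => b = false ∧ e' = e]
  rw [condProb, houtput, hbit, mul_div_cancel_left₀ _ (by positivity)]

end Sample

theorem formula_mem_satProb {d : ℕ} {I : SuccInstance}
    (h : I ∈ SuccETR (1 / 8) (-(1 / 8)) (1 / 8)) : formula d I ∈ SatProb (d + 2) := by
  obtain ⟨x, hx, heqs⟩ := h
  have hq (e) : 4 * x e + 1 / 2 ∈ Set.Icc (0 : ℝ) 1 := by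
    obtain ⟨hlow, hhigh⟩ := hx e
    constructor <;> linarith
  obtain ⟨n, hn⟩ : ∃ n, outVar I.M 7 I.N = n := ⟨_, rfl⟩
  have hn6 : 6 ≤ n := by simp only [outVar] at hn; omega
  have hbelow : ∀ k < I.N, outVar I.M 7 k < n := by simp only [outVar] at hn ⊢; omega
  refine ⟨formula_closed I, n, formula_varsBelow hn6 I hbelow, sampleModel d I.M n hq,
    fun ρ => ⟨(tableProduct_pos_iff _).mpr (sampleModel_hasRows hq hn6), ?_⟩⟩
  refine SCM.weighted_le_weighted fun ρ' hpath => ?_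
  obtain ⟨j, hj⟩ := (sampleModel_onlyRows hq hn6).layers_value hpath
  simp only [NatPoly.toTerm_eval_of_encodes _ hj, condProb_sampleModel hq hn.le]
  exact (side_value_le_iff (x := fun i => x ((I.C i).eval j)) (hx _).2).mpr (heqs j)

theorem mem_succETR_iff (d : ℕ) (I : SuccInstance) :
    I ∈ SuccETR (1 / 8) (-(1 / 8)) (1 / 8) ↔ formula d I ∈ SatProb (d + 2) :=
  ⟨formula_mem_satProb, fun ⟨_, _, _, _, h⟩ => mem_succETR_of_models h⟩

end SuccReduction

/-! ## Interpreting stack instructions on a Turing machine -/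

section InstrSet

open Turing Function

theorem initList_eq (tm : FinTM2) (s : List (tm.Γ tm.k₀)) :
    initList tm s = ⟨some tm.main, tm.initialState, update (fun _ => []) tm.k₀ s⟩ := by
  refine congrArg (TM2.Cfg.mk _ _) (funext fun k => ?_)
  rw [update]
  split
  · subst_vars; rfl
  · rfl

theorem haltList_eq (tm : FinTM2) (s : List (tm.Γ tm.k₁)) :
    haltList tm s = ⟨none, tm.initialState, update (fun _ => []) tm.k₁ s⟩ := by
  refine congrArg (TM2.Cfg.mk _ _) (funext fun k => ?_)
  rw [update]
  split
  · subst_vars; rfl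
  · rfl

/-- What an instruction does once it has read its stack: schedule the instructions `next` ahead of
those already pending, and push the symbols `push k` on each stack `k`, in the order listed. -/
structure Effect {K : Type} (Γ : K → Type) (I : Type) where
  next : List I := []
  push : ∀ k, List (Γ k) := fun _ => []

/-- The semantics of instructions `I` working on stacks indexed by `K`: the instruction `i` pops
the stack `source i`, if any, and its effect depends on the symbol found there. -/
structure InstrSet {K : Type} (Γ : K → Type) (I : Type) where
  source : I → Option K
  effect : I → Option (Σ k, Γ k) → Effect Γ I

namespace InstrSet

section Runs

variable {K : Type} [DecidableEq K] {Γ : K → Type} {I : Type} (A : InstrSet Γ I)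

/-- The symbol that the instruction `i` reads. -/
def popped (i : I) (S : ∀ k, List (Γ k)) : Option (Σ k, Γ k) :=
  (A.source i).bind fun k => (S k).head?.map (Sigma.mk k)

/-- The stacks once the instruction `i` has read its symbol. -/
def afterPop (i : I) (S : ∀ k, List (Γ k)) : ∀ k, List (Γ k) :=
  (A.source i).elim S fun k => update S k (S k).tail

/-- The instructions that `i` schedules. -/
def next (i : I) (S : ∀ k, List (Γ k)) : List I :=
  (A.effect i (A.popped i S)).next

/-- The stacks after executing the instruction `i`. -/
def step (i : I) (S : ∀ k, List (Γ k)) (k : K) : List (Γ k) :=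
  ((A.effect i (A.popped i S)).push k).reverse ++ A.afterPop i S k

/-- Executing the list of instructions turns the first family of stacks into the second within the
given number of instructions. -/
inductive Runs : ℕ → List I → (∀ k, List (Γ k)) → (∀ k, List (Γ k)) → Prop
  | nil (b : ℕ) (S) : Runs b [] S S
  | cons {b : ℕ} {i : I} {l : List I} {S S'} (h : Runs b (A.next i S ++ l) (A.step i S) S') :
    Runs (b + 1) (i :: l) S S'

variable {A}

theorem Runs.step {b : ℕ} {i : I} {l l' : List I} {S S₁ S' : ∀ k, List (Γ k)}
    (hnext : A.next i S = l') (hstep : ∀ k, A.step i S k = S₁ k) (h : A.Runs b (l' ++ l) S₁ S') :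
    A.Runs (b + 1) (i :: l) S S' := by
  obtain rfl : A.step i S = S₁ := funext hstep
  exact .cons (hnext ▸ h)

theorem Runs.mono {b b' : ℕ} {l : List I} {S S' : ∀ k, List (Γ k)} (h : A.Runs b l S S')
    (hb : b ≤ b') : A.Runs b' l S S' := by
  induction h generalizing b' with
  | nil => exact .nil _ _
  | cons _ ih =>
    obtain ⟨b', rfl⟩ := Nat.exists_eq_add_of_le' (Nat.one_le_of_lt hb)
    exact .cons (ih (Nat.le_of_succ_le_succ hb))

theorem Runs.append {b b' : ℕ} {l l' : List I} {S S' S'' : ∀ k, List (Γ k)}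
    (h : A.Runs b l S S') (h' : A.Runs b' l' S' S'') : A.Runs (b + b') (l ++ l') S S'' := by
  induction h with
  | nil => exact h'.mono (Nat.le_add_left _ _)
  | cons _ ih =>
    rw [Nat.add_right_comm]
    exact .cons (List.append_assoc _ _ _ ▸ ih h')

theorem afterPop_length_le (i : I) (S : ∀ k, List (Γ k)) (k : K) :
    (A.afterPop i S k).length ≤ (S k).length := by
  rw [afterPop]
  rcases A.source i with _ | k'
  · exact le_rfl
  · rcases eq_or_ne k k' with rfl | hk
    · simp
    · simp [hk]

theorem Runs.length_le (A : InstrSet Γ I) [Finite K] [∀ k, Finite (Γ k)] [Finite I] :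
    ∃ g, ∀ b l S S', A.Runs b l S S' → ∀ k, (S' k).length ≤ (S k).length + g * b := by
  have := Fintype.ofFinite ((I × Option (Σ k, Γ k)) × K)
  let pushed (a : (I × Option (Σ k, Γ k)) × K) : ℕ := ((A.effect a.1.1 a.1.2).push a.2).length
  refine ⟨Finset.univ.sup pushed, fun b l S S' h k => ?_⟩
  induction h with
  | nil => exact Nat.le_add_right _ _
  | @cons b i _ S S' _ ih =>
    have step_le : (A.step i S k).length ≤ Finset.univ.sup pushed + (S k).length := by
      rw [InstrSet.step, List.length_append, List.length_reverse]
      exact Nat.add_le_add (Finset.le_sup (f := pushed) (Finset.mem_univ ((i, A.popped i S), k)))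
        (afterPop_length_le i S k)
    linarith

end Runs

section Machine

variable {K : Type} (Γ : K → Type) (I : Type)

/-- The alphabets of the interpreter: besides the stacks in `K` it has one, indexed by `none`, for
the pending instructions. -/
abbrev Cell : Option K → Type
  | none => I
  | some k => Γ k

/-- The control states of the interpreter: load the program, fetch an instruction, read its
symbol, and carry out its effect. -/
inductive Label
  | start
  | fetch
  | exec (o : Option I)
  | emit (i : I) (v : Option (Σ k, Γ k))

noncomputable instance [Fintype K] [∀ k, Fintype (Γ k)] [Fintype I] : Fintype (Label Γ I) :=
  let label : Option (Option (Option I ⊕ I × Option (Σ k, Γ k))) → Label Γ I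
    | none => .start
    | some none => .fetch
    | some (some (.inl o)) => .exec o
    | some (some (.inr (i, v))) => .emit i v
  letI := Classical.decEq (Label Γ I)
  .ofSurjective label fun
    | .start => ⟨none, rfl⟩
    | .fetch => ⟨some none, rfl⟩
    | .exec o => ⟨some (some (.inl o)), rfl⟩
    | .emit i v => ⟨some (some (.inr (i, v))), rfl⟩

/-- The internal memory of the interpreter: an instruction just fetched and a symbol just read. -/
abbrev Register : Type := Option I × Option (Σ k, Γ k)

variable {Γ I}

/-- The stacks of the interpreter with pending instructions `l`. -/
def withPending (l : List I) (S : ∀ k, List (Γ k)) : ∀ k, List (Cell Γ I k)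
  | none => l
  | some k => S k

variable [DecidableEq K]

theorem update_withPending_none (l l' : List I) (S : ∀ k, List (Γ k)) :
    update (withPending l S) none l' = withPending l' S := by
  funext k
  cases k <;> rfl

theorem update_withPending_some (l : List I) (S : ∀ k, List (Γ k)) (k : K) (s : List (Γ k)) :
    update (withPending (I := I) l S) (some k) s = withPending l (update S k s) := by
  funext k'
  rcases k' with _ | k'
  · rfl
  · rcases eq_or_ne k' k with rfl | hk
    · exact (update_self _ _ _).trans (update_self (β := fun k => List (Γ k)) _ _ _).symm
    · exact (update_of_ne (mt (Option.some.inj ·) hk) _ _).trans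
        (update_of_ne (β := fun k => List (Γ k)) hk _ _).symm

theorem update_nil_some (k : K) (s : List (Γ k)) :
    update (β := fun k => List (Cell Γ I k)) (fun _ => []) (some k) s =
      withPending [] (update (fun _ => []) k s) := by
  rw [← update_withPending_some]
  congr
  funext k
  cases k <;> rfl

/-- The statements of the interpreter, as a machine with the stacks `Cell Γ I`. -/
abbrev Stmt (Γ : K → Type) (I : Type) : Type := TM2.Stmt (Cell Γ I) (Label Γ I) (Register Γ I)

/-- Push the symbols of `l` on the stack `k`, the last one on top, and go on with `q`. -/
def pushList (k : Option K) (l : List (Cell Γ I k)) (q : Stmt Γ I) : Stmt Γ I :=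
  l.foldr (fun a q => .push k (fun _ => a) q) q

theorem stepAux_pushList (k : Option K) (l : List (Cell Γ I k)) (q : Stmt Γ I)
    (v : Register Γ I) (S : ∀ k, List (Cell Γ I k)) :
    TM2.stepAux (pushList k l q) v S = TM2.stepAux q v (update S k (l.reverse ++ S k)) := by
  induction l generalizing S with
  | nil => simp [pushList]
  | cons a l ih => exact (ih _).trans (by simp)

/-- Push `w k` on each of the stacks `k` in `ks` and go on with `q`. -/
def pushLists (ks : List (Option K)) (w : ∀ k, List (Cell Γ I k)) (q : Stmt Γ I) : Stmt Γ I :=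
  ks.foldr (fun k q => pushList k (w k) q) q

theorem stepAux_pushLists {ks : List (Option K)} (hks : ks.Nodup) (w : ∀ k, List (Cell Γ I k))
    (q : Stmt Γ I) (v : Register Γ I) (S : ∀ k, List (Cell Γ I k)) :
    TM2.stepAux (pushLists ks w q) v S =
      TM2.stepAux q v fun k => if k ∈ ks then (w k).reverse ++ S k else S k := by
  induction ks generalizing S with
  | nil => simp [pushLists]
  | cons k ks ih =>
    obtain ⟨hk, hks⟩ := List.nodup_cons.mp hks
    refine (stepAux_pushList _ _ _ _ _).trans ((ih hks _).trans (congrArg _ (funext fun k' => ?_)))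
    rcases eq_or_ne k' k with rfl | hk'
    · simp [hk]
    · simp [hk']

variable [Fintype K] (A : InstrSet Γ I)

/-- The program of the interpreter. -/
noncomputable def stmt (prog : List I) : Label Γ I → Stmt Γ I
  | .start => pushList none (prog.reverse : List I) (.goto fun _ => .fetch)
  | .fetch => .pop none (fun _ i => (i, none)) (.goto fun v => .exec v.1)
  | .exec none => .halt
  | .exec (some i) =>
    let proceed : Stmt Γ I := .goto fun v => .emit i v.2
    (A.source i).elim (.load (fun _ => (none, none)) proceed) fun k =>
      .pop (some k) (fun _ s => (none, s.map (Sigma.mk k))) proceed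
  | .emit i v =>
    let e := A.effect i v
    pushLists Finset.univ.toList (withPending e.next.reverse e.push)
      (.load (fun _ => (none, none)) (.goto fun _ => .fetch))

/-- The Turing machine that executes the program `prog` on the input stack `k₀`. -/
noncomputable def machine [∀ k, Fintype (Γ k)] [Fintype I] (prog : List I) (k₀ k₁ : K) :
    FinTM2 where
  K := Option K
  k₀ := some k₀
  k₁ := some k₁
  Γ := Cell Γ I
  Λ := Label Γ I
  main := .start
  σ := Register Γ I
  initialState := (none, none)
  Γk₀Fin := inferInstanceAs (Fintype (Γ k₀))
  m := A.stmt prog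

variable {A}

/-- The configuration in which the next instruction is about to be fetched from `l`. -/
def fetching (l : List I) (S : ∀ k, List (Γ k)) : TM2.Cfg (Cell Γ I) (Label Γ I) (Register Γ I) :=
  ⟨some .fetch, (none, none), withPending l S⟩

theorem step_start (prog : List I) (S : ∀ k, List (Γ k)) :
    TM2.step (A.stmt prog) ⟨some .start, (none, none), withPending [] S⟩ =
      some (fetching prog S) := by
  refine congrArg some ((stepAux_pushList _ _ _ _ _).trans (congrArg (TM2.Cfg.mk _ _) ?_))
  rw [update_withPending_none]
  exact congrArg (withPending · S) ((List.append_nil _).trans (List.reverse_reverse prog))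

theorem step_fetch_nil (prog : List I) (S : ∀ k, List (Γ k)) :
    TM2.step (A.stmt prog) (fetching [] S) =
      some ⟨some (.exec none), (none, none), withPending [] S⟩ :=
  congrArg some (congrArg (TM2.Cfg.mk _ _) (update_withPending_none _ _ S))

theorem step_fetch_cons (prog : List I) (i : I) (l : List I) (S : ∀ k, List (Γ k)) :
    TM2.step (A.stmt prog) (fetching (i :: l) S) =
      some ⟨some (.exec (some i)), (some i, none), withPending l S⟩ :=
  congrArg some (congrArg (TM2.Cfg.mk _ _) (update_withPending_none _ _ S))

theorem step_exec (prog : List I) (i : I) (v : Register Γ I) (l : List I) (S : ∀ k, List (Γ k)) :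
    TM2.step (A.stmt prog) ⟨some (.exec (some i)), v, withPending l S⟩ =
      some ⟨some (.emit i (A.popped i S)), (none, A.popped i S),
        withPending l (A.afterPop i S)⟩ := by
  refine congrArg some ?_
  rw [stmt, popped, afterPop]
  cases A.source i with
  | none => rfl
  | some k => exact congrArg (TM2.Cfg.mk _ _) (update_withPending_some _ _ _ _)

theorem step_emit (prog : List I) (i : I) (l : List I) (v : Register Γ I) (S : ∀ k, List (Γ k)) :
    TM2.step (A.stmt prog) ⟨some (.emit i (A.popped i S)), v, withPending l (A.afterPop i S)⟩ =
      some (fetching (A.next i S ++ l) (A.step i S)) := by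
  refine congrArg some ((stepAux_pushLists (Finset.nodup_toList _) _ _ _ _).trans
    (congrArg (TM2.Cfg.mk _ _) (funext fun k => ?_)))
  simp only [Finset.mem_toList, Finset.mem_univ, if_true]
  cases k with
  | none => exact congrArg (· ++ l) (List.reverse_reverse _)
  | some k => rfl

theorem iterate_step_instr (prog : List I) (i : I) (l : List I) (S : ∀ k, List (Γ k)) :
    (flip bind (TM2.step (A.stmt prog)))^[3] (some (fetching (i :: l) S)) =
      some (fetching (A.next i S ++ l) (A.step i S)) := by
  let run := flip bind (TM2.step (A.stmt prog))
  exact (congrArg (run^[2]) (step_fetch_cons prog i l S)).trans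
    ((congrArg run (step_exec prog i _ l S)).trans (step_emit prog i l _ S))

theorem iterate_step_nil (prog : List I) (S : ∀ k, List (Γ k)) :
    (flip bind (TM2.step (A.stmt prog)))^[2] (some (fetching [] S)) =
      some ⟨none, (none, none), withPending [] S⟩ :=
  congrArg (flip bind (TM2.step (A.stmt prog))) (step_fetch_nil prog S)

/-- Three steps of the machine per instruction, and two for noticing that none is left. -/
theorem Runs.exists_halts (prog : List I) {b : ℕ} {l : List I} {S S' : ∀ k, List (Γ k)}
    (h : A.Runs b l S S') : ∃ n ≤ 3 * b + 2,
      (flip bind (TM2.step (A.stmt prog)))^[n] (some (fetching l S)) =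
        some ⟨none, (none, none), withPending [] S'⟩ := by
  induction h with
  | nil b S => exact ⟨2, Nat.le_add_left _ _, iterate_step_nil prog S⟩
  | @cons b i l S S' _ ih =>
    obtain ⟨n, hn, hrun⟩ := ih
    refine ⟨n + 3, by omega, ?_⟩
    rw [iterate_add_apply, iterate_step_instr, hrun]

variable [∀ k, Fintype (Γ k)] [Fintype I]

theorem initList_machine (prog : List I) (k₀ k₁ : K) (s : List (Γ k₀)) :
    initList (A.machine prog k₀ k₁) s =
      ⟨some .start, (none, none), withPending [] (update (fun _ => []) k₀ s)⟩ :=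
  (initList_eq _ _).trans (congrArg (TM2.Cfg.mk _ _) (update_nil_some k₀ s))

theorem haltList_machine (prog : List I) (k₀ k₁ : K) (s : List (Γ k₁)) :
    haltList (A.machine prog k₀ k₁) s =
      ⟨none, (none, none), withPending [] (update (fun _ => []) k₁ s)⟩ :=
  (haltList_eq _ _).trans (congrArg (TM2.Cfg.mk _ _) (update_nil_some k₁ s))

theorem exists_machine_halts (prog : List I) {b : ℕ} {k₀ k₁ : K} {s : List (Γ k₀)}
    {t : List (Γ k₁)} (h : A.Runs b prog (update (fun _ => []) k₀ s) (update (fun _ => []) k₁ t)) :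
    ∃ n ≤ 3 * b + 3, (flip bind (A.machine prog k₀ k₁).step)^[n]
      (some (initList (A.machine prog k₀ k₁) s)) = some (haltList (A.machine prog k₀ k₁) t) := by
  obtain ⟨n, hn, hrun⟩ := h.exists_halts prog
  refine ⟨n + 1, Nat.succ_le_succ hn, ?_⟩
  rw [iterate_succ_apply, initList_machine, haltList_machine]
  exact (congrArg (flip bind (A.machine prog k₀ k₁).step)^[n]
    (step_start (A := A) prog _)).trans hrun

/-- A program whose runs turn the code of `a` on the stack `k₀` into the code of `f a` on the
stack `k₁` computes `f`. -/
noncomputable def computableInPolyTime {α β : Type} {f : α → β} {k₀ k₁ : K}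
    {ea : α → List (Γ k₀)} {eb : β → List (Γ k₁)} (prog : List I) (time : Polynomial ℕ)
    (h : ∀ a, A.Runs (time.eval (ea a).length) prog (update (fun _ => []) k₀ (ea a))
      (update (fun _ => []) k₁ (eb (f a)))) :
    TM2ComputableInPolyTime ea eb f where
  tm := A.machine prog k₀ k₁
  inputAlphabet := Equiv.refl _
  outputAlphabet := Equiv.refl _
  time := 3 * time + 3
  outputsFun a := by
    have halts (s : List (Γ k₀)) (t : List (Γ k₁)) (hs : s = ea a) (ht : t = eb (f a)) :
        ∃ n ≤ (3 * time + 3).eval (ea a).length, (flip bind (A.machine prog k₀ k₁).step)^[n]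
          (some (initList (A.machine prog k₀ k₁) s)) =
            some (haltList (A.machine prog k₀ k₁) t) := by
      subst hs ht
      simpa only [Polynomial.eval_add, Polynomial.eval_mul, Polynomial.eval_ofNat] using
        exists_machine_halts prog (h a)
    have halts := halts _ _ (List.map_id (ea a)) (List.map_id (eb (f a)))
    exact ⟨⟨halts.choose, halts.choose_spec.2⟩, halts.choose_spec.1⟩

end Machine

end InstrSet

end InstrSet

/-! ## A program that writes the formula -/

section Encode

variable {c : ℕ}

/-- The string that a layer contributes to the code of a nested weighted sum. -/
def SumLayer.encode (l : SumLayer c) : List FSym :=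
  .sum :: (FSym.num l.var ++ .mul :: .prob :: l.weight.encode)

theorem ProbTerm.weighted_encode (ls : List (SumLayer c)) (t : ProbTerm c) :
    (weighted ls t).encode = ls.flatMap SumLayer.encode ++ t.encode := by
  induction ls with
  | nil => rfl
  | cons l ls ih =>
    have unfold : (weighted (l :: ls) t).encode = .sum :: (FSym.num l.var ++
      .mul :: (.prob :: l.weight.encode ++ (weighted ls t).encode)) := rfl
    simp [unfold, ih, SumLayer.encode]

end Encode

namespace SuccReduction

/-- The instructions of the reduction. Apart from `sym`, which writes a symbol of the formula, and
`mark`, which pushes a bit on the counter, every instruction is a loop that reads one symbol per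
round. -/
inductive Instr : Type
  | sym (a : FSym)
  | walk (r : Fin 8)
  | mark (b : Bool)
  | reset
  | num
  | inputs
  | outputs
  | gates
  | outs (i : Fin 7)
  | event (i : Fin 7)
  | clear
  | rewind
  | drain
  | flip
  deriving Fintype

/-- The stacks: unread and read input, a counter, the output in reverse, and the output. -/
inductive Stk : Type
  | inp | read | cnt | acc | out
  deriving DecidableEq

instance : Fintype Stk where
  elems := {.inp, .read, .cnt, .acc, .out}
  complete k := by cases k <;> simp

/-- The alphabets of the stacks. -/
abbrev Stk.Sym : Stk → Type
  | .inp | .read => CSym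
  | .cnt => Bool
  | .acc | .out => FSym

instance : ∀ k : Stk, Fintype k.Sym
  | .inp | .read => inferInstanceAs (Fintype CSym)
  | .cnt => inferInstanceAs (Fintype Bool)
  | .acc | .out => inferInstanceAs (Fintype FSym)

/-- The contents of all stacks, where those not mentioned are empty. -/
def stores (inp read : List CSym := []) (cnt : List Bool := []) (acc out : List FSym := []) :
    ∀ k : Stk, List k.Sym
  | .inp => inp
  | .read => read
  | .cnt => cnt
  | .acc => acc
  | .out => out

/-- Write a list of symbols. -/
def syms (l : List FSym) : List Instr := l.map .sym

/-- Write `link X y`, where `l` writes `y`. -/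
def linkProg (X : ℕ) (l : List Instr) : List Instr :=
  syms (.eq :: (FSym.num X ++ [.dummy])) ++ l

/-- Write the layer with the variable that `y` writes and the weight that `δ` writes. -/
def layerProg (y δ : List Instr) : List Instr :=
  .sym .sum :: (y ++ (.sym .mul :: .sym .prob :: δ))

/-- Write the layer of a gate with two children, whose truth table is that of `X`. -/
def binaryProg (X : ℕ) : List Instr :=
  layerProg [.walk 7] (.sym .conj :: (linkProg X [.walk 7] ++
    (.sym .conj :: (linkProg 0 [.num] ++ linkProg 1 [.num]))))

/-- The event `¬ falsum`, written out. -/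
def verumSyms : List FSym := (PropFormula.neg (falsum (d := 0))).encode

/-- The effect of an instruction on the symbol it has read. With `u` symbols on the counter,
`walk r` writes the number `8 * u + r`, and `num` writes `node u` when it reads the number `u`.
The other instructions write, in this order, the layers of the input nodes, of the gates and of the
outputs of circuit `i`, and the event of circuit `i`. -/
def effect : Instr → Option (Σ k : Stk, k.Sym) → Effect Stk.Sym Instr
  | .sym a, _ => { push := stores (acc := [a]) }
  | .walk r, some ⟨.cnt, b⟩ =>
    { push := stores (acc := List.replicate 8 .one), next := [.walk r, .mark b] }
  | .walk r, _ => { push := stores (acc := FSym.num r) }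
  | .mark b, _ => { push := stores (cnt := [b]) }
  | .reset, some ⟨.cnt, false⟩ => { next := [.reset] }
  | .reset, some ⟨.cnt, true⟩ => { push := stores (cnt := [true]) }
  | .num, some ⟨.inp, .one⟩ =>
    { push := stores (read := [.one]) (acc := List.replicate 8 .one), next := [.num] }
  | .num, some ⟨.inp, .sep⟩ => { push := stores (read := [.sep]) (acc := FSym.num 7) }
  | .inputs, some ⟨.inp, .one⟩ =>
    { push := stores (read := [.one]),
      next := layerProg [.walk 7] (linkProg 0 [.walk 7]) ++ [.mark true, .inputs] }
  | .inputs, some ⟨.inp, .sep⟩ => { push := stores (read := [.sep]) }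
  | .outputs, some ⟨.inp, .one⟩ =>
    { push := stores (read := [.one]) (cnt := [false]), next := [.outputs] }
  | .outputs, some ⟨.inp, .sep⟩ => { push := stores (read := [.sep]) }
  | .gates, some ⟨.inp, .neg⟩ =>
    { push := stores (read := [.neg]),
      next := layerProg [.walk 7] (.sym .conj :: (linkProg 2 [.walk 7] ++ linkProg 0 [.num])) ++
        [.mark false, .gates] }
  | .gates, some ⟨.inp, .conj⟩ =>
    { push := stores (read := [.conj]), next := binaryProg 3 ++ [.mark false, .gates] }
  | .gates, some ⟨.inp, .disj⟩ =>
    { push := stores (read := [.disj]), next := binaryProg 4 ++ [.mark false, .gates] }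
  | .gates, some ⟨.inp, .out⟩ => { push := stores (read := [.out]) }
  | .outs _, some ⟨.inp, .done⟩ => { push := stores (read := [.done]) }
  | .outs i, some ⟨.inp, a⟩ =>
    { push := stores (inp := [a]),
      next := layerProg [.walk i.castSucc]
          (.sym .conj :: (linkProg 0 [.walk i.castSucc] ++ linkProg 0 [.num])) ++
        [.mark false, .outs i] }
  | .event i, some ⟨.cnt, false⟩ =>
    { next := [.sym .conj, .sym .eq, .walk 7, .sym .dummy, .walk i.castSucc, .event i,
        .mark false] }
  | .event _, some ⟨.cnt, true⟩ => { push := stores (cnt := [true]), next := syms verumSyms }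
  | .event _, _ => { next := syms verumSyms }
  | .clear, some _ => { next := [.clear] }
  | .rewind, some ⟨.read, a⟩ => { push := stores (inp := [a]), next := [.rewind] }
  | .drain, some _ => { next := [.drain] }
  | .flip, some ⟨.acc, a⟩ => { push := stores (out := [a]), next := [.flip] }
  | _, _ => {}

/-- The stack that an instruction reads. -/
def source : Instr → Option Stk
  | .sym _ | .mark _ => none
  | .walk _ | .reset | .event _ | .clear => some .cnt
  | .num | .inputs | .outputs | .gates | .outs _ | .drain => some .inp
  | .rewind => some .read
  | .flip => some .acc

/-- The instructions of the reduction and their meaning. -/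
def writer : InstrSet Stk.Sym Instr := ⟨source, effect⟩

/-- Write a polynomial in the seven conditional probabilities. -/
def NatPoly.prog : NatPoly → List Instr
  | .one => syms (.prob :: verumSyms)
  | .var i => syms (.cond :: .eq :: (FSym.num 5 ++ .const :: FSym.num 0)) ++ [.event i]
  | .add p q => .sym .add :: (p.prog ++ q.prog)
  | .mul p q => .sym .mul :: (p.prog ++ q.prog)

/-- Write the layers of circuit `i`. -/
def circuitProg (i : Fin 7) : List Instr := [.reset, .gates, .reset, .outs i]

/-- Write a side of the inequality. -/
def sideProg (left : Bool) : List Instr :=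
  [.inputs, .outputs] ++ ((List.finRange 7).flatMap circuitProg ++ (side left).prog)

/-- Write a side of the inequality and restore all the stacks but that of the output. -/
def passProg (left : Bool) : List Instr := sideProg left ++ [.clear, .rewind]

/-- The part of the formula that does not depend on the instance. -/
def constantSyms : List FSym :=
  .conj :: .neg :: .le :: ((tableProduct (d := 0)).encode ++ .prob :: (falsum (d := 0)).encode) ++
    [.le]

/-- Write the formula of the instance on the input stack. -/
def program : List Instr :=
  syms constantSyms ++ (passProg true ++ (passProg false ++ [.drain, .flip]))

/-- Within `b` instructions, `l` reads `x`, writes `s` and changes the counter from `cnt` to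
`cnt'`. -/
def Writes (b : ℕ) (l : List Instr) (x : List CSym) (cnt cnt' : List Bool) (s : List FSym) :
    Prop :=
  ∀ rest read acc, writer.Runs b l (stores (x ++ rest) read cnt acc)
    (stores rest (x.reverse ++ read) cnt' (s.reverse ++ acc))

/-- The counter when circuits with `M` input nodes have reached node `M + k`, the last symbol pushed
first. The symbols of the inputs are `true`, so that `reset` knows where to stop. -/
def counter (M k : ℕ) : List Bool := List.replicate k false ++ List.replicate M true

theorem counter_length (M k : ℕ) : (counter M k).length = M + k := by
  simp [counter, Nat.add_comm]

theorem num_add_eight (n : ℕ) : FSym.num (n + 8) = List.replicate 8 .one ++ FSym.num n := by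
  rw [FSym.num, strokes, Nat.add_comm, List.replicate_add, List.append_assoc]
  rfl

theorem num_length (u : ℕ) : (CSym.num u).length = u + 1 := by
  simp [CSym.num, strokes]

theorem link_encode {c : ℕ} (X y : ℕ) :
    (link X y : PropFormula c).encode = .eq :: (FSym.num X ++ [.dummy]) ++ FSym.num y := by
  simp [link, PropFormula.encode, ValTerm.encode]

theorem verum_encode {d : ℕ} : (PropFormula.neg (falsum (d := d))).encode = verumSyms := by
  simp [verumSyms, falsum, PropFormula.encode, ValTerm.encode]

theorem le_add_length_encode {n m : ℕ} (G : GateList n m) : m ≤ n + G.encode.length := by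
  induction G with
  | nil => exact Nat.le_add_right _ _
  | cons g rest ih =>
    have : 1 ≤ g.encode.length := by cases g <;> simp [Gate.encode]
    simp only [GateList.encode, List.length_append]
    omega

theorem nodes_le_length (I : SuccInstance) (i : Fin 7) : (I.C i).nodes ≤ I.encode.length := by
  have nodes_le := le_add_length_encode (I.C i).gates
  have circuit_le := (List.sublist_flatten_of_mem
    (List.mem_ofFn.mpr ⟨i, rfl⟩ : (I.C i).encode ∈ List.ofFn fun i => (I.C i).encode)).length_le
  rw [Circuit.encode, List.length_append] at circuit_le
  rw [SuccInstance.encode, List.length_append, List.length_append, num_length]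
  omega

namespace Writes

variable {b b' : ℕ} {l l' : List Instr} {x x' : List CSym} {cnt cnt' cnt'' : List Bool}
  {s s' : List FSym}

theorem mono (h : Writes b l x cnt cnt' s) (hb : b ≤ b') : Writes b' l x cnt cnt' s :=
  fun rest read acc => (h rest read acc).mono hb

theorem nil (cnt : List Bool) : Writes 0 [] [] cnt cnt [] := fun _ _ _ => .nil _ _

theorem append (h : Writes b l x cnt cnt' s) (h' : Writes b' l' x' cnt' cnt'' s') :
    Writes (b + b') (l ++ l') (x ++ x') cnt cnt'' (s ++ s') := by
  intro rest read acc
  have hrun := (h (x' ++ rest) read acc).append (h' rest (x.reverse ++ read) (s.reverse ++ acc))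
  simpa only [List.append_assoc, List.reverse_append] using hrun

theorem cons {i : Instr} (h : Writes b [i] x cnt cnt' s) (h' : Writes b' l x' cnt' cnt'' s') :
    Writes (b + b') (i :: l) (x ++ x') cnt cnt'' (s ++ s') :=
  h.append h'

theorem round {i : Instr} {y : List CSym} {t : List FSym}
    (hnext : ∀ rest read acc, writer.next i (stores (y ++ x ++ rest) read cnt acc) = l)
    (hstep : ∀ rest read acc k, writer.step i (stores (y ++ x ++ rest) read cnt acc) k =
      stores (x ++ rest) (y.reverse ++ read) cnt' (t.reverse ++ acc) [] k)
    (h : Writes b l x cnt' cnt'' s) : Writes (b + 1) [i] (y ++ x) cnt cnt'' (t ++ s) := by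
  intro rest read acc
  refine .step (hnext rest read acc) (hstep rest read acc) ?_
  simpa only [List.append_nil, List.append_assoc, List.reverse_append] using
    h rest (y.reverse ++ read) (t.reverse ++ acc)

theorem last {i : Instr} {y : List CSym} {t : List FSym}
    (hnext : ∀ rest read acc, writer.next i (stores (y ++ rest) read cnt acc) = [])
    (hstep : ∀ rest read acc k, writer.step i (stores (y ++ rest) read cnt acc) k =
      stores rest (y.reverse ++ read) cnt' (t.reverse ++ acc) [] k) :
    Writes 1 [i] y cnt cnt' t :=
  fun rest read acc => .step (hnext rest read acc) (hstep rest read acc) (.nil _ _)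

theorem sym (a : FSym) (cnt : List Bool) : Writes 1 [.sym a] [] cnt cnt [a] :=
  last (fun _ _ _ => rfl) fun _ _ _ k => by cases k <;> rfl

theorem sym_cons (a : FSym) (h : Writes b l x cnt cnt' s) :
    Writes (b + 1) (.sym a :: l) x cnt cnt' (a :: s) :=
  ((sym a cnt).append h).mono (Nat.add_comm 1 b).le

theorem syms (l : List FSym) (cnt : List Bool) : Writes l.length (syms l) [] cnt cnt l := by
  induction l with
  | nil => exact nil cnt
  | cons a l ih => exact sym_cons a ih

theorem mark (b : Bool) (cnt : List Bool) : Writes 1 [.mark b] [] cnt (b :: cnt) [] :=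
  last (fun _ _ _ => rfl) fun _ _ _ k => by cases k <;> rfl

theorem walk (r : Fin 8) (cnt : List Bool) :
    Writes (2 * cnt.length + 1) [.walk r] [] cnt cnt (FSym.num (8 * cnt.length + r)) := by
  induction cnt with
  | nil =>
    simp only [List.length_nil, Nat.mul_zero, Nat.zero_add]
    exact last (fun _ _ _ => rfl) fun _ _ _ k => by cases k <;> rfl
  | cons b cnt ih =>
    rw [List.length_cons, Nat.mul_succ 8, Nat.add_right_comm, num_add_eight]
    have h := ih.append (mark b cnt)
    rw [List.append_nil (FSym.num _)] at h
    exact round (y := []) (x := []) (fun _ _ _ => rfl) (fun _ _ _ k => by cases k <;> rfl) h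

theorem walk_counter {B M k : ℕ} (r : Fin 8) (hB : M + k ≤ B) :
    Writes (2 * B + 2) [.walk r] [] (counter M k) (counter M k) (FSym.num (8 * (M + k) + r)) := by
  rw [← counter_length M k] at hB ⊢
  exact (walk r _).mono (by omega)

theorem num (u : ℕ) (cnt : List Bool) :
    Writes (u + 1) [.num] (CSym.num u) cnt cnt (FSym.num (node u)) := by
  induction u with
  | zero => exact last (y := [.sep]) (fun _ _ _ => rfl) fun _ _ _ k => by cases k <;> rfl
  | succ u ih =>
    rw [show node (u + 1) = node u + 8 by simp only [node]; omega, num_add_eight]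
    exact round (y := [.one]) (fun _ _ _ => rfl) (fun _ _ _ k => by cases k <;> rfl) ih

theorem outputs (M n k : ℕ) :
    Writes (n + 1) [.outputs] (CSym.num n) (counter M k) (counter M (k + n)) [] := by
  induction n generalizing k with
  | zero => exact last (y := [.sep]) (fun _ _ _ => rfl) fun _ _ _ k => by cases k <;> rfl
  | succ n ih =>
    rw [← Nat.add_assoc k, Nat.add_right_comm k]
    exact round (y := [.one]) (t := []) (fun _ _ _ => rfl) (fun _ _ _ k => by cases k <;> rfl)
      (ih (k + 1))

theorem reset (M k : ℕ) : Writes (k + 1) [.reset] [] (counter M k) (counter M 0) [] := by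
  induction k with
  | zero =>
    cases M <;> exact last (fun _ _ _ => rfl) fun _ _ _ k => by cases k <;> rfl
  | succ k ih =>
    exact round (y := []) (t := []) (fun _ _ _ => rfl) (fun _ _ _ k => by cases k <;> rfl) ih

theorem clear (cnt : List Bool) : Writes (cnt.length + 1) [.clear] [] cnt [] [] := by
  induction cnt with
  | nil => exact last (fun _ _ _ => rfl) fun _ _ _ k => by cases k <;> rfl
  | cons b cnt ih =>
    exact round (y := []) (t := []) (fun _ _ _ => rfl) (fun _ _ _ k => by cases k <;> rfl) ih

section Layers

variable {c : ℕ} {δ δ' : PropFormula c} {B M k y : ℕ}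

theorem link (X : ℕ) (h : Writes b l x cnt cnt' (FSym.num y)) :
    Writes (X + 3 + b) (linkProg X l) x cnt cnt' (link X y : PropFormula c).encode := by
  rw [link_encode]
  exact ((syms _ cnt).append h).mono (by simp [FSym.num, strokes])

theorem conj (h : Writes b l x cnt cnt' δ.encode) (h' : Writes b' l' x' cnt' cnt'' δ'.encode) :
    Writes (b + b' + 1) (.sym .conj :: (l ++ l')) (x ++ x') cnt cnt'' (δ.conj δ').encode :=
  sym_cons .conj (h.append h')

theorem layer (h : Writes b l [] cnt cnt (FSym.num y)) (h' : Writes b' l' x cnt cnt' δ.encode) :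
    Writes (b + b' + 3) (layerProg l l') x cnt cnt' (SumLayer.encode ⟨y, δ⟩) :=
  sym_cons .sum (h.append (sym_cons .mul (sym_cons .prob h')))

theorem inputs {j m : ℕ} (hB : j + m ≤ B) :
    Writes ((4 * B + 20) * (m + 1)) [.inputs] (CSym.num m) (counter j 0) (counter (j + m) 0)
      ((inputLayers (c := c) j m).flatMap SumLayer.encode) := by
  induction m generalizing j with
  | zero =>
    exact mono (last (y := [.sep]) (t := []) (fun _ _ _ => rfl) fun _ _ _ k => by cases k <;> rfl)
      (by omega)
  | succ m ih =>
    have name := walk_counter (M := j) (k := 0) 7 (Nat.le_of_add_right_le hB)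
    have body := (name.layer (name.link (c := c) 0)).append
      ((mark true (counter j 0)).append (ih (j := j + 1) (by omega)))
    rw [← Nat.add_assoc j, Nat.add_right_comm j]
    refine mono (round (y := [.one]) (t := []) (fun _ _ _ => rfl)
      (fun _ _ _ k => by cases k <;> rfl) body) ?_
    rw [Nat.mul_succ _ (m + 1)]
    omega

theorem binary (X u w : ℕ) (hB : M + k ≤ B) :
    Writes (4 * B + 21 + X + u + w) (binaryProg X) (CSym.num u ++ CSym.num w)
      (counter M k) (counter M k)
      (SumLayer.encode (c := c) ⟨node (M + k), .conj (SuccReduction.link X (node (M + k)))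
        (.conj (SuccReduction.link 0 (node u)) (SuccReduction.link 1 (node w)))⟩) := by
  have name := walk_counter 7 hB
  exact (name.layer ((name.link X).conj (((num u _).link 0).conj ((num w _).link 1)))).mono
    (by omega)

theorem gates_cons (g : Gate (M + k)) (hB : M + k ≤ B)
    (h : Writes b [.gates] x (counter M (k + 1)) cnt s) :
    Writes ((4 * B + 30) * g.encode.length + b) [.gates] (g.encode ++ x) (counter M k) cnt
      ((gateLayer (c := c) g).encode ++ s) := by
  have rest := (mark false (counter M k)).append h
  cases g with
  | neg u =>
    have name := walk_counter 7 hB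
    have body := (name.layer ((name.link (c := c) 2).conj ((num u _).link 0))).append rest
    refine mono (round (y := [.neg]) (t := []) (fun _ _ _ => rfl)
      (fun _ _ _ k => by cases k <;> rfl) body) ?_
    simp only [Gate.encode, List.length_cons, num_length]
    nlinarith
  | conj u w =>
    have body := (binary (c := c) 3 u w hB).append rest
    refine mono (round (y := [.conj]) (t := []) (fun _ _ _ => rfl)
      (fun _ _ _ k => by cases k <;> rfl) body) ?_
    simp only [Gate.encode, List.length_cons, List.length_append, num_length]
    nlinarith
  | disj u w =>
    have body := (binary (c := c) 4 u w hB).append rest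
    refine mono (round (y := [.disj]) (t := []) (fun _ _ _ => rfl)
      (fun _ _ _ k => by cases k <;> rfl) body) ?_
    simp only [Gate.encode, List.length_cons, List.length_append, num_length]
    nlinarith

theorem gates {n m : ℕ} (G : GateList n m) (hk : M + k = n) (hB : m ≤ B) :
    Writes ((4 * B + 30) * G.encode.length) [.gates] G.encode (counter M k) (counter M (m - M))
      ((gateLayers (c := c) G).flatMap SumLayer.encode) := by
  induction G generalizing k with
  | nil n =>
    rw [← hk, Nat.add_sub_cancel_left]
    exact mono (last (y := [.out]) (t := []) (fun _ _ _ => rfl) fun _ _ _ k => by cases k <;> rfl)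
      (Nat.le_mul_of_pos_left _ (by omega))
  | cons g rest ih =>
    subst hk
    rw [GateList.encode, List.length_append, Nat.mul_add]
    exact gates_cons g (Nat.le_of_succ_le ((le_of_gateList rest).trans hB))
      (ih (Nat.add_assoc _ _ _).symm hB)

theorem outs_cons (i : Fin 7) (u : ℕ) (hB : M + k ≤ B)
    (h : Writes b [.outs i] x (counter M (k + 1)) cnt s) :
    Writes ((4 * B + 30) * (u + 1) + b) [.outs i] (CSym.num u ++ x) (counter M k) cnt
      (SumLayer.encode (c := c) ⟨outVar M i k, .conj (SuccReduction.link 0 (outVar M i k))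
        (SuccReduction.link 0 (node u))⟩ ++ s) := by
  have name : Writes _ _ _ _ _ (FSym.num (outVar M i k)) := walk_counter i.castSucc hB
  have body := (name.layer ((name.link (c := c) 0).conj ((num u _).link 0))).append
    ((mark false (counter M k)).append h)
  cases u <;> exact mono (round (y := []) (t := []) (fun _ _ _ => rfl)
    (fun _ _ _ k => by cases k <;> rfl) body) (by nlinarith)

theorem outs (i : Fin 7) (us : List ℕ) (hB : M + k + us.length ≤ B) :
    Writes ((4 * B + 30) * (us.flatMap CSym.num ++ [CSym.done]).length) [.outs i]
      (us.flatMap CSym.num ++ [CSym.done]) (counter M k) (counter M (k + us.length))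
      ((outLayers (c := c) M i k us).flatMap SumLayer.encode) := by
  induction us generalizing k with
  | nil =>
    exact mono (last (y := [.done]) (t := []) (fun _ _ _ => rfl) fun _ _ _ k => by cases k <;> rfl)
      (Nat.le_mul_of_pos_left _ (by omega))
  | cons u us ih =>
    rw [List.length_cons] at hB
    rw [List.flatMap_cons, List.append_assoc, List.length_append, num_length, Nat.mul_add,
      List.length_cons, ← Nat.add_assoc k, Nat.add_right_comm k]
    exact outs_cons (B := B) i u (by omega) (ih (k := k + 1) (by omega))

theorem circuit {N : ℕ} (i : Fin 7) (C : Circuit M N) (hN : M + N ≤ B) (hC : C.nodes ≤ B) :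
    Writes (2 * (4 * B + 30) * C.encode.length) (circuitProg i) C.encode (counter M N)
      (counter M N) ((circuitLayers (c := c) i C).flatMap SumLayer.encode) := by
  set us := List.ofFn fun k => (C.out k : ℕ) with hus
  have us_length : us.length = N := List.length_ofFn
  have encode_eq : C.encode = C.gates.encode ++ (us.flatMap CSym.num ++ [.done]) := by
    rw [Circuit.encode, List.flatMap, hus, List.map_ofFn]
    rfl
  have h := (reset M N).cons ((gates (c := c) C.gates rfl hC).cons
    ((reset M (C.nodes - M)).cons (outs (c := c) (B := B) (M := M) (k := 0) i us (by omega))))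
  rw [us_length, Nat.zero_add] at h
  rw [encode_eq, circuitLayers, List.flatMap_append]
  refine mono h ?_
  have resets : N + 1 + (C.nodes - M + 1) ≤
      (4 * B + 30) * (C.gates.encode ++ (us.flatMap CSym.num ++ [CSym.done])).length :=
    le_trans (by omega) (Nat.le_mul_of_pos_right (4 * B + 30) (by simp))
  rw [Nat.mul_assoc, Nat.two_mul]
  refine le_trans ?_ (Nat.add_le_add_right resets _)
  rw [List.length_append (as := C.gates.encode), Nat.mul_add]
  omega

theorem circuits (I : SuccInstance) (hN : I.M + I.N ≤ B) (hC : ∀ i, (I.C i).nodes ≤ B)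
    (is : List (Fin 7)) :
    Writes (2 * (4 * B + 30) * (is.map fun i => (I.C i).encode).flatten.length)
      (is.flatMap circuitProg) (is.map fun i => (I.C i).encode).flatten (counter I.M I.N)
      (counter I.M I.N) ((circuitsLayers (c := c) I is).flatMap SumLayer.encode) := by
  induction is with
  | nil => exact nil _
  | cons i is ih =>
    have h := (circuit (c := c) i (I.C i) hN (hC i)).append ih
    rw [← Nat.mul_add, ← List.length_append] at h
    simpa [circuitsLayers] using h

end Layers

section Side

variable {d B M N : ℕ}

theorem event (i : Fin 7) (hB : M + N ≤ B) :
    Writes (N * (4 * B + 10) + 15) [.event i] [] (counter M N) (counter M N)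
      (SuccReduction.event (d := d) M i N).encode := by
  induction N with
  | zero =>
    rw [SuccReduction.event, verum_encode]
    have verum := syms verumSyms (counter M 0)
    have verumSyms_length : verumSyms.length = 11 := rfl
    cases M <;>
      exact mono (round (y := []) (t := []) (fun _ _ _ => rfl)
        (fun _ _ _ k => by cases k <;> rfl) verum) (by omega)
  | succ k ih =>
    have name (r : Fin 8) := walk_counter (B := B) (M := M) (k := k) r (by omega)
    have body := sym_cons .conj (sym_cons .eq ((name 7).append (sym_cons .dummy
      ((name i.castSucc).append ((ih (by omega)).append (mark false (counter M k)))))))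
    have encode_eq : (SuccReduction.event (d := d) M i (k + 1)).encode =
        .conj :: .eq :: (FSym.num (outVar M 7 k) ++ .dummy :: (FSym.num (outVar M i k) ++
          ((SuccReduction.event (d := d) M i k).encode ++ []))) := by
      simp [SuccReduction.event, PropFormula.encode, link_encode]
    rw [encode_eq, Nat.succ_mul]
    exact mono (round (y := []) (t := []) (fun _ _ _ => rfl)
      (fun _ _ _ k => by cases k <;> rfl) body) (by omega)

theorem exists_poly (p : NatPoly) : ∃ g, ∀ {d B M N : ℕ}, M + N ≤ B →
    Writes (g * (B + 1) ^ 2) p.prog [] (counter M N) (counter M N)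
      (p.toTerm (d := d) M N).encode := by
  induction p with
  | one =>
    refine ⟨12, fun {d B M N} _ => ?_⟩
    rw [NatPoly.toTerm, ProbTerm.encode, verum_encode]
    exact (syms (.prob :: verumSyms) _).mono (Nat.le_mul_of_pos_right 12 (by positivity))
  | var i =>
    refine ⟨40, fun {d B M N} hB => ?_⟩
    have h := (syms (.cond :: .eq :: (FSym.num 5 ++ .const :: FSym.num 0)) _).append
      (event (d := d) i hB)
    have encode_eq : ((NatPoly.var i).toTerm (d := d) M N).encode =
        .cond :: .eq :: (FSym.num 5 ++ .const :: FSym.num 0) ++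
          (SuccReduction.event (d := d) M i N).encode := by
      simp [NatPoly.toTerm, ProbTerm.encode, PropFormula.encode, ValTerm.encode]
    rw [encode_eq]
    refine mono h ?_
    have prefix_length :
      (.cond :: .eq :: (FSym.num 5 ++ .const :: FSym.num 0) : List FSym).length = 10 := rfl
    have : N * (4 * B + 10) ≤ B * (4 * B + 10) := Nat.mul_le_mul_right _ (by omega)
    rw [prefix_length]
    nlinarith
  | add p q hp hq =>
    obtain ⟨g, hg⟩ := hp
    obtain ⟨g', hg'⟩ := hq
    exact ⟨g + g' + 1, fun hB => (sym_cons .add ((hg hB).append (hg' hB))).mono (by nlinarith)⟩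
  | mul p q hp hq =>
    obtain ⟨g, hg⟩ := hp
    obtain ⟨g', hg'⟩ := hq
    exact ⟨g + g' + 1, fun hB => (sym_cons .mul ((hg hB).append (hg' hB))).mono (by nlinarith)⟩

theorem exists_side (left : Bool) : ∃ g, ∀ {d : ℕ} (I : SuccInstance),
    Writes (g * (I.encode.length + 1) ^ 2) (sideProg left) I.encode (counter 0 0)
      (counter I.M I.N) (sideTerm (d := d) I left).encode := by
  obtain ⟨g, hg⟩ := exists_poly (side left)
  refine ⟨g + 100, fun {d} I => ?_⟩
  set circuitCodes := ((List.finRange 7).map fun i => (I.C i).encode).flatten with hcodes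
  have encode_eq : I.encode = CSym.num I.M ++ (CSym.num I.N ++ circuitCodes) := by
    rw [SuccInstance.encode, List.ofFn_eq_map]
  have length_eq := congrArg List.length encode_eq
  rw [List.length_append, List.length_append, num_length, num_length] at length_eq
  have sizes := (inputs (c := d + 2) (B := I.encode.length) (j := 0) (m := I.M) (by omega)).cons
    (outputs _ I.N 0)
  rw [Nat.zero_add, Nat.zero_add] at sizes
  have h := sizes.append <|
    (circuits (c := d + 2) I (by omega) (nodes_le_length I) (List.finRange 7)).append <|
      hg (d := d) (B := I.encode.length) (M := I.M) (N := I.N) (by omega)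
  simp only [List.append_nil, List.append_assoc, ← hcodes, ← encode_eq] at h
  rw [sideTerm, ProbTerm.weighted_encode, layers, List.flatMap_append, List.append_assoc]
  refine mono h ?_
  have inputs_time : (4 * I.encode.length + 20) * (I.M + 1) ≤
    (4 * I.encode.length + 20) * I.encode.length := Nat.mul_le_mul_left _ (by omega)
  have circuits_time : 2 * (4 * I.encode.length + 30) * circuitCodes.length ≤
    2 * (4 * I.encode.length + 30) * I.encode.length := Nat.mul_le_mul_left _ (by omega)
  nlinarith

end Side

end Writes

section Program

variable {d : ℕ}

theorem runs_rewind (inp read : List CSym) (acc : List FSym) :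
    writer.Runs (read.length + 1) [.rewind] (stores inp read [] acc)
      (stores (read.reverse ++ inp) [] [] acc) := by
  induction read generalizing inp with
  | nil => exact .step rfl (fun k => by cases k <;> rfl) (.nil _ _)
  | cons a read ih =>
    rw [List.reverse_cons, List.append_assoc]
    exact .step rfl (fun k => by cases k <;> rfl) (ih (a :: inp))

theorem runs_drain (inp : List CSym) (acc : List FSym) :
    writer.Runs (inp.length + 1) [.drain] (stores inp (acc := acc)) (stores (acc := acc)) := by
  induction inp with
  | nil => exact .step rfl (fun k => by cases k <;> rfl) (.nil _ _)
  | cons a inp ih => exact .step rfl (fun k => by cases k <;> rfl) ih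

theorem runs_flip (acc out : List FSym) :
    writer.Runs (acc.length + 1) [.flip] (stores (acc := acc) (out := out))
      (stores (out := acc.reverse ++ out)) := by
  induction acc generalizing out with
  | nil => exact .step rfl (fun k => by cases k <;> rfl) (.nil _ _)
  | cons a acc ih =>
    rw [List.reverse_cons, List.append_assoc]
    exact .step rfl (fun k => by cases k <;> rfl) (ih (a :: out))

theorem exists_runs_pass (left : Bool) : ∃ g, ∀ {d : ℕ} (I : SuccInstance) (acc : List FSym),
    writer.Runs (g * (I.encode.length + 1) ^ 2) (passProg left) (stores I.encode (acc := acc))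
      (stores I.encode (acc := (sideTerm (d := d) I left).encode.reverse ++ acc)) := by
  obtain ⟨g, hg⟩ := Writes.exists_side left
  refine ⟨g + 2, fun {d} I acc => ?_⟩
  have h := (((hg (d := d) I).append (.clear _)) [] [] acc).append (runs_rewind [] _ _)
  have inputs_outputs_le : I.M + I.N ≤ I.encode.length := by
    rw [SuccInstance.encode, List.length_append, List.length_append, num_length, num_length]
    omega
  simp only [List.append_nil, List.reverse_reverse, List.append_assoc, List.length_reverse,
    counter_length] at h
  refine h.mono ?_
  nlinarith

theorem tableProduct_encode :
    (tableProduct (d := d)).encode = (tableProduct (d := 0)).encode := by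
  simp [tableProduct, tableRow, code, ProbTerm.encode, PropFormula.encode, ValTerm.encode]

theorem formula_encode (I : SuccInstance) : (formula d I).encode =
    constantSyms ++ ((sideTerm (d := d) I true).encode ++ (sideTerm (d := d) I false).encode) := by
  have falsum_encode : (falsum (d := d)).encode = (falsum (d := 0)).encode := by
    simp [falsum, PropFormula.encode, ValTerm.encode]
  rw [formula, ProbFormula.encode, ProbFormula.encode, ProbFormula.encode, ProbFormula.encode,
    tableProduct_encode, ProbTerm.encode.eq_1, falsum_encode]
  simp [constantSyms]

theorem exists_runs_reverse : ∃ g, ∀ {d : ℕ} (I : SuccInstance),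
    writer.Runs (g * (I.encode.length + 1) ^ 2)
      (syms constantSyms ++ (passProg true ++ (passProg false ++ [.drain])))
      (stores I.encode) (stores (acc := (formula d I).encode.reverse)) := by
  obtain ⟨g, hg⟩ := exists_runs_pass true
  obtain ⟨g', hg'⟩ := exists_runs_pass false
  refine ⟨constantSyms.length + g + g' + 1, fun {d} I => ?_⟩
  have h := ((Writes.syms constantSyms []) I.encode [] []).append ((hg (d := d) I _).append
    ((hg' (d := d) I _).append (runs_drain _ _)))
  rw [formula_encode, List.reverse_append, List.reverse_append]
  simp only [List.append_nil, List.append_assoc] at h ⊢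
  refine h.mono ?_
  have constant_time : constantSyms.length ≤ constantSyms.length * (I.encode.length + 1) ^ 2 :=
    Nat.le_mul_of_pos_right _ (by positivity)
  have drain_time : I.encode.length + 1 ≤ (I.encode.length + 1) ^ 2 :=
    Nat.le_self_pow two_ne_zero _
  linarith

theorem exists_runs_program : ∃ g, ∀ {d : ℕ} (I : SuccInstance),
    writer.Runs (g * (I.encode.length + 1) ^ 2) program (stores I.encode)
      (stores (out := (formula d I).encode)) := by
  obtain ⟨g, hg⟩ := exists_runs_reverse
  obtain ⟨a, ha⟩ := InstrSet.Runs.length_le writer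
  refine ⟨g + a * g + 1, fun {d} I => ?_⟩
  have length_le := ha _ _ _ _ (hg (d := d) I) .acc
  have h := (hg (d := d) I).append (runs_flip (formula d I).encode.reverse [])
  rw [List.reverse_reverse, List.append_nil] at h
  simp only [List.append_assoc] at h
  refine h.mono ?_
  simp only [stores, List.length_nil, Nat.zero_add] at length_le
  have one_le : 1 ≤ (I.encode.length + 1) ^ 2 := Nat.one_le_pow _ _ (Nat.succ_pos _)
  linarith

theorem update_inp (s : List CSym) :
    Function.update (fun k : Stk => ([] : List k.Sym)) .inp s = stores s :=
  funext fun k => by cases k <;> rfl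

theorem update_out (s : List FSym) :
    Function.update (fun k : Stk => ([] : List k.Sym)) .out s = stores (out := s) :=
  funext fun k => by cases k <;> rfl

/-- The reduction is computed in quadratic time. -/
noncomputable def computableInPolyTime (d : ℕ) :
    Turing.TM2ComputableInPolyTime SuccInstance.encode (ProbFormula.encode (c := d + 2))
      (formula d) :=
  writer.computableInPolyTime (k₀ := .inp) (k₁ := .out) program
    (Polynomial.C exists_runs_program.choose * (Polynomial.X + 1) ^ 2) fun I => by
      rw [update_inp, update_out]
      simpa using exists_runs_program.choose_spec I

end Program

end SuccReduction

theorem proposition3 (c : ℕ) (hc : 2 ≤ c) :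
    PolyTimeReducible SuccInstance.encoding (ProbFormula.encoding c)
      (SuccETR (1 / 8) (-(1 / 8)) (1 / 8)) (SatProb c) := by
  obtain ⟨d, rfl⟩ := Nat.exists_eq_add_of_le' hc
  exact ⟨SuccReduction.formula d, ⟨SuccReduction.computableInPolyTime d⟩,
    SuccReduction.mem_succETR_iff d⟩
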